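/- A tournament is a finite directed graph without loops in which, for any two distinct vertices $x,y$, exactly one of the arcs $(x,y)$, $(y,x)$ is present; it is transitive if it contains no directed cycle. A tournament $T$ contains a tournament $S$ if $S$ is isomorphic to a subtournament of $T$ induced by some set of vertices; $T$ is $(H_1,\dots,H_k)$-free if it contains none of $H_1,\dots,H_k$. We say that $(H_1,\dots,H_k)$ satisfy the Erdős–Hajnal Conjecture if there is $\epsilon>0$ such that every $(H_1,\dots,H_k)$-free tournament with $n$ vertices contains a transitive subtournament with at least $n^{\epsilon}$ vertices. Given an ordering of the vertices of a tournament, an arc is backward if its tail comes after its head in the ordering. Write $N^+(x)$ and $N^-(x)$ for the sets of out-neighbours and in-neighbours of $x$. Let $S_6$ be the tournament with the ordering $(v,a,b,c,f,e,d)$ of its vertices and the set of backward arcs $\{(f,v),(d,a),(e,b),(e,a)\}$, and $S_{11}$ the tournament with the ordering $(b,c,v,a,d,e,f)$ and the set of backward arcs $\{(f,c),(f,v),(d,v),(a,b),(e,b)\}$. Let $C_5$ be the tournament on $v_1,\dots,v_5$ with the arcs $(v_i,v_{i+1})$ and $(v_i,v_{i+2})$, indices modulo $5$. Let $L_1$ be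 $C_5$ with an added vertex $v_6$ with $N^+(v_6)=\{v_5\}$, and $L_2$ be $C_5$ with an added vertex $v_6$ with $N^-(v_6)=\{v_1,v_2,v_4\}$. The following tournaments are obtained by adding one vertex $v_7$. To $L_1$: - $H_5$: $N^-(v_7)=\{v_1,v_3\}$; - $H_{14}$: $N^-(v_7)=\{v_3,v_4,v_5\}$; - $H_{19}$: $N^-(v_7)=\{v_5\}$; - $H_{22}$: $N^+(v_7)=\{v_1,v_3,v_6\}$; - $H_{42}$: $N^-(v_7)=\{v_1,v_6\}$. To $L_2$: - $H_{24}$: $N^-(v_7)=\{v_5\}$; - $H_{28}$: $N^-(v_7)=\{v_1,v_4\}$; - $H_{33}$: $N^+(v_7)=\{v_2,v_5\}$; - $H_{36}$: $N^-(v_7)=\{v_1,v_6\}$; - $H_{49}$: $N^+(v_7)=\{v_2,v_3\}$. **Theorem.** Each of the triplets $(S_6,H_{14},H_{22})$, $(S_{11},H_{42},H_{49})$, $(H_{24},H_{28},H_{36})$ and $(H_5,H_{19},H_{33})$ satisfies the Erdős–Hajnal Conjecture. -/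

import Mathlib

universe u

/-- A tournament: a loopless digraph in which, for any two distinct vertices `x`, `y`,
exactly one of the arcs `(x, y)`, `(y, x)` is present. `T.Adj x y` means `x → y`. -/
structure Tournament (V : Type*) extends Digraph V where
  loopless : ∀ x, ¬ Adj x x
  exactly_one : ∀ x y, x ≠ y → Xor (Adj x y) (Adj y x)

namespace Tournament

/-- The subtournament `T | X` induced by a set of vertices `X`. -/
def induce {V : Type*} (T : Tournament V) (X : Set V) : Tournament X where
  Adj x y := T.Adj x y
  loopless x := T.loopless x
  exactly_one x y h := T.exactly_one x y fun e => h (Subtype.ext e)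

/-- `T` contains `S`: some induced subtournament of `T` is isomorphic to `S`. -/
def Contains {V W : Type*} (T : Tournament V) (S : Tournament W) : Prop :=
  ∃ X : Set V, Nonempty (S.Adj ≃r (T.induce X).Adj)

/-- A tournament is transitive if it has no directed cycle (no vertex can be reached from
itself by a directed walk of positive length). -/
def IsTransitive {V : Type*} (T : Tournament V) : Prop :=
  ∀ x, ¬ Relation.TransGen T.Adj x x

/-- The tournaments `H 0, …, H (k - 1)` (each with `m` vertices) together satisfy the
Erdős–Hajnal conjecture: for some `ε > 0`, every finite tournament containing none of them has a
transitive subtournament with at least `n ^ ε` vertices, `n` being its number of vertices. -/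
def SatisfyEHC {k m : ℕ} (H : Fin k → Tournament (Fin m)) : Prop :=
  ∃ ε : ℝ, 0 < ε ∧ ∀ (V : Type u) [Fintype V] (T : Tournament V),
    (∀ i, ¬ T.Contains (H i)) →
      ∃ X : Finset V, (T.induce (X : Set V)).IsTransitive ∧
        (Fintype.card V : ℝ) ^ ε ≤ (X.card : ℝ)

/-- The tournament on the vertices `0, …, n - 1`, taken in this order, whose set of backward arcs
`(i, j)`, `i > j`, is `B`; all other arcs go forward. -/
def ofBackward {n : ℕ} (B : Finset (Fin n × Fin n)) : Tournament (Fin n) where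
  Adj i j := (i < j ∧ (j, i) ∉ B) ∨ (j < i ∧ (i, j) ∈ B)
  loopless i := by simp
  exactly_one i j h := by
    rcases lt_or_gt_of_ne h with h | h <;> by_cases h' : (j, i) ∈ B <;>
      by_cases h'' : (i, j) ∈ B <;> simp [Xor, h, h', h'', h.not_gt]

/-- The tournament `T + v` obtained from `T` by adding one vertex `v` (the last one) with
out-neighbourhood `N`; the in-neighbourhood of `v` is then the complement `Nᶜ`. -/
def addVertex {n : ℕ} (T : Tournament (Fin n)) (N : Finset (Fin n)) :
    Tournament (Fin (n + 1)) where
  Adj i j :=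
    (∃ x y, i = Fin.castSucc x ∧ j = Fin.castSucc y ∧ T.Adj x y) ∨
    (i = Fin.last n ∧ ∃ y ∈ N, j = Fin.castSucc y) ∨
    (j = Fin.last n ∧ ∃ x ∉ N, i = Fin.castSucc x)
  loopless i := by
    induction i using Fin.lastCases with
    | last => simp [(Fin.castSucc_ne_last _).symm]
    | cast i => simpa [Fin.castSucc_ne_last] using T.loopless i
  exactly_one i j h := by
    induction i using Fin.lastCases with
    | last =>
      induction j using Fin.lastCases with
      | last => exact absurd rfl h
      | cast j =>
        by_cases hj : j ∈ N <;> simp [Xor, hj, Fin.castSucc_ne_last, (Fin.castSucc_ne_last _).symm]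
    | cast i =>
      induction j using Fin.lastCases with
      | last =>
        by_cases hi : i ∈ N <;> simp [Xor, hi, Fin.castSucc_ne_last, (Fin.castSucc_ne_last _).symm]
      | cast j =>
        simpa [Fin.castSucc_ne_last] using T.exactly_one i j fun e => h (by rw [e])

/-! In the following tournaments `C5`, `L1`, `L2`, `H…` the vertex `v_k` is `k - 1`. -/

/-- The regular tournament on five vertices, `v_i → v_{i+1}, v_{i+2}` (indices modulo `5`). -/
def C5 : Tournament (Fin 5) where
  Adj i j := j = i + 1 ∨ j = i + 2
  loopless := by decide
  exactly_one := by simp only [Xor]; decide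

/-- `C5 + v₆` with `N⁺(v₆) = {v₅}`. -/
def L1 : Tournament (Fin 6) := C5.addVertex {4}

/-- `C5 + v₆` with `N⁻(v₆) = {v₁, v₂, v₄}`. -/
def L2 : Tournament (Fin 6) := C5.addVertex {0, 1, 3}ᶜ

/-- Ordering `(v, a, b, c, f, e, d)`, backward arcs `(f, v), (d, a), (e, b), (e, a)`. -/
def S6 : Tournament (Fin 7) := ofBackward {(4, 0), (6, 1), (5, 2), (5, 1)}

/-- Ordering `(b, c, v, a, d, e, f)`,
backward arcs `(f, c), (f, v), (d, v), (a, b), (e, b)`. -/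
def S11 : Tournament (Fin 7) := ofBackward {(6, 1), (6, 2), (4, 2), (3, 0), (5, 0)}

/-- `L1 + v₇` with `N⁻(v₇) = {v₁, v₃}`. -/
def H5 : Tournament (Fin 7) := L1.addVertex {0, 2}ᶜ

/-- `L1 + v₇` with `N⁻(v₇) = {v₃, v₄, v₅}`. -/
def H14 : Tournament (Fin 7) := L1.addVertex {2, 3, 4}ᶜ

/-- `L1 + v₇` with `N⁻(v₇) = {v₅}`. -/
def H19 : Tournament (Fin 7) := L1.addVertex {4}ᶜ

/-- `L1 + v₇` with `N⁺(v₇) = {v₁, v₃, v₆}`. -/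
def H22 : Tournament (Fin 7) := L1.addVertex {0, 2, 5}

/-- `L2 + v₇` with `N⁻(v₇) = {v₅}`. -/
def H24 : Tournament (Fin 7) := L2.addVertex {4}ᶜ

/-- `L2 + v₇` with `N⁻(v₇) = {v₁, v₄}`. -/
def H28 : Tournament (Fin 7) := L2.addVertex {0, 3}ᶜ

/-- `L2 + v₇` with `N⁺(v₇) = {v₂, v₅}`. -/
def H33 : Tournament (Fin 7) := L2.addVertex {1, 4}

/-- `L2 + v₇` with `N⁻(v₇) = {v₁, v₆}`. -/
def H36 : Tournament (Fin 7) := L2.addVertex {0, 5}ᶜ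

/-- `L1 + v₇` with `N⁻(v₇) = {v₁, v₆}`. -/
def H42 : Tournament (Fin 7) := L1.addVertex {0, 5}ᶜ

/-- `L2 + v₇` with `N⁺(v₇) = {v₂, v₃}`. -/
def H49 : Tournament (Fin 7) := L2.addVertex {1, 2}

end Tournament

/-! In each triplet two members suffice: one follows a path pattern (`pathPairs`), the other a
triangle pattern (`trianglePairs`). In both, the backward arcs form a core on a, e, x, y and a star
with centre z and leaves f, g; the cores are the path x-e-a-y, and the two triangles aex, aey
sharing the edge ae.

For small ε, take a minimal set X with no transitive subset of size |X|^ε (`Critical`) in a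
tournament avoiding both members. Avoiding one of them already yields, by greedy embedding and
iteration, seven blocks of size linear in |X| with almost all arcs forward (`exists_blocks`). By
minimality every linear-sized proper subset of X has a transitive subset of nearly |X|^ε vertices,
so it cannot be complete to, or from, a transitive set of even |X|^ε / 160 vertices: their union
would be too large (`Critical.not_complete`). Cutting a transitive subset of one block into nine
parts gives fifteen layers (`Critical.exists_layered`). Backward arcs between them are rare at each
vertex, yet unavoidable between large parts of two layers one of which is linear.

Now choose a backward pair a, e in outer layers, each with backward neighbours in three of the
transitive layers. Each of these three either contains a common backward neighbour of a and e or
does not, so two of them agree. Common neighbours in both give the triangle core; in neither, the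
path core (`Layered.contains_or_contains`). Since backward arcs are rare, the star and a free vertex
w can be added with all other arcs forward (`Layered.exists_extension`). -/

namespace Tournament

/-! ### Basic facts and embeddings -/

section Basic

variable {V W : Type*} (T : Tournament V)

theorem ne_of_adj {x y : V} (h : T.Adj x y) : x ≠ y := by
  rintro rfl
  exact T.loopless _ h

theorem not_adj_of_adj {x y : V} (h : T.Adj x y) : ¬ T.Adj y x := by
  rcases T.exactly_one x y (T.ne_of_adj h) with h' | h'
  · exact h'.2
  · exact fun _ => h'.2 h

theorem adj_of_not_adj {x y : V} (hne : x ≠ y) (h : ¬ T.Adj x y) : T.Adj y x := by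
  rcases T.exactly_one x y hne with hxor | hxor
  · exact absurd hxor.1 h
  · exact hxor.1

/-- A map that preserves arcs exhibits a copy of its source. -/
theorem contains_of_map (S : Tournament W) (f : W → V)
    (hf : ∀ i j, S.Adj i j → T.Adj (f i) (f j)) : T.Contains S := by
  have hiff : ∀ i j, T.Adj (f i) (f j) ↔ S.Adj i j := by
    refine fun i j => ⟨fun h => ?_, hf i j⟩
    by_contra hij
    have hne : i ≠ j := by
      rintro rfl
      exact T.loopless _ h
    exact T.not_adj_of_adj h (hf _ _ (S.adj_of_not_adj hne hij))
  have hinj : Function.Injective f := by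
    intro i j hij
    by_contra hne
    by_cases h : S.Adj i j
    · exact T.ne_of_adj (hf _ _ h) hij
    · exact T.ne_of_adj (hf _ _ (S.adj_of_not_adj hne h)) hij.symm
  exact ⟨Set.range f, ⟨⟨Equiv.ofInjective f hinj, fun {i j} => hiff i j⟩⟩⟩

end Basic

instance {n : ℕ} (T : Tournament (Fin n)) [DecidableRel T.Adj] (N : Finset (Fin n)) :
    DecidableRel (T.addVertex N).Adj := fun i j =>
  inferInstanceAs (Decidable ((∃ x y, i = Fin.castSucc x ∧ j = Fin.castSucc y ∧ T.Adj x y) ∨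
    (i = Fin.last n ∧ ∃ y ∈ N, j = Fin.castSucc y) ∨
    (j = Fin.last n ∧ ∃ x ∉ N, i = Fin.castSucc x)))

instance : DecidableRel C5.Adj := fun i j => inferInstanceAs (Decidable (j = i + 1 ∨ j = i + 2))

instance : DecidableRel L1.Adj := inferInstanceAs (DecidableRel (C5.addVertex _).Adj)

instance : DecidableRel L2.Adj := inferInstanceAs (DecidableRel (C5.addVertex _).Adj)

/-! ### Labelled patterns

Eight labelled vertices `a, e, x, y, z, f, g, w` are chosen in linearly ordered layers. The set
`P` records the pairs of labels joined by a backward arc; every other arc is forward. -/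

/-- `H` is the tournament formed by the labels `τ 0, …, τ 6`, in this order, with set of backward
pairs `P`. -/
def IsPattern (P : Finset (Fin 8 × Fin 8)) (τ : Fin 7 → Fin 8) (H : Tournament (Fin 7)) : Prop :=
  ∃ σ : Fin 7 → Fin 7, ∀ i j, H.Adj i j →
    (σ i < σ j ∧ (τ (σ i), τ (σ j)) ∉ P ∧ (τ (σ j), τ (σ i)) ∉ P) ∨
    (σ j < σ i ∧ ((τ (σ i), τ (σ j)) ∈ P ∨ (τ (σ j), τ (σ i)) ∈ P))

/-- The backward pairs `ae, ay, ex, zf, zg`. -/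
def pathPairs : Finset (Fin 8 × Fin 8) := {(0, 1), (0, 3), (1, 2), (4, 5), (4, 6)}

/-- The backward pairs `ae, ax, ay, ex, ey, zf, zg`. -/
def trianglePairs : Finset (Fin 8 × Fin 8) :=
  {(0, 1), (0, 2), (0, 3), (1, 2), (1, 3), (4, 5), (4, 6)}

/-- The witness sends each vertex to its place in the list of labels. Seven of the eight labels
occur: `H36` has both leaves f, g and no w, while the other patterns omit g. -/
theorem isPattern_H14 : IsPattern pathPairs ![0, 2, 5, 7, 3, 1, 4] H14 :=
  ⟨![4, 5, 0, 1, 2, 6, 3], by unfold H14; decide⟩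

theorem isPattern_H42 : IsPattern pathPairs ![0, 5, 2, 7, 3, 4, 1] H42 :=
  ⟨![0, 2, 3, 4, 6, 5, 1], by unfold H42; decide⟩

theorem isPattern_H5 : IsPattern pathPairs ![0, 4, 2, 5, 3, 7, 1] H5 :=
  ⟨![0, 2, 3, 4, 6, 5, 1], by unfold H5; decide⟩

theorem isPattern_H36 : IsPattern pathPairs ![0, 5, 2, 6, 3, 4, 1] H36 :=
  ⟨![0, 2, 3, 4, 6, 5, 1], by unfold H36; decide⟩

theorem isPattern_H22 : IsPattern trianglePairs ![0, 4, 2, 7, 5, 3, 1] H22 :=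
  ⟨![4, 1, 6, 2, 0, 5, 3], by unfold H22; decide⟩

theorem isPattern_H49 : IsPattern trianglePairs ![0, 4, 2, 7, 3, 5, 1] H49 :=
  ⟨![2, 0, 5, 1, 6, 3, 4], by unfold H49; decide⟩

theorem isPattern_H24 : IsPattern trianglePairs ![0, 2, 5, 3, 7, 4, 1] H24 :=
  ⟨![3, 0, 5, 2, 6, 4, 1], by unfold H24; decide⟩

theorem isPattern_H19 : IsPattern trianglePairs ![0, 2, 5, 3, 4, 7, 1] H19 :=
  ⟨![3, 0, 4, 2, 6, 5, 1], by unfold H19; decide⟩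

section Layers

variable {V : Type*} (T : Tournament V)

/-- The arc between `x`, in layer `i`, and `y`, in layer `j`, goes from the lower layer to the
higher one. -/
def Fwd (i j : ℕ) (x y : V) : Prop := if i < j then T.Adj x y else T.Adj y x

theorem fwd_of_lt {i j : ℕ} {x y : V} (h : i < j) : T.Fwd i j x y ↔ T.Adj x y := by
  simp [Fwd, h]

theorem fwd_of_gt {i j : ℕ} {x y : V} (h : j < i) : T.Fwd i j x y ↔ T.Adj y x := by
  simp [Fwd, h.not_gt]

theorem fwd_comm {i j : ℕ} {x y : V} (h : i ≠ j) : T.Fwd i j x y ↔ T.Fwd j i y x := by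
  rcases lt_or_gt_of_ne h with h | h <;> simp [Fwd, h, h.not_gt]

/-- A choice of labelled vertices in layers, with backward pairs `P`, yields a copy of every
tournament following a pattern compatible with the layers. -/
theorem contains_of_isPattern {P : Finset (Fin 8 × Fin 8)} {τ : Fin 7 → Fin 8}
    {H : Tournament (Fin 7)} (hH : IsPattern P τ H) (β : Fin 8 → ℕ) (v : Fin 8 → V)
    (hτ : StrictMono (β ∘ τ))
    (hv : ∀ k l, k < l → v k ≠ v l ∧ (T.Fwd (β k) (β l) (v k) (v l) ↔ (k, l) ∉ P))
    (hP : ∀ p ∈ P, p.1 < p.2) : T.Contains H := by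
  obtain ⟨σ, hσ⟩ := hH
  have key : ∀ k l, β k < β l → (T.Adj (v k) (v l) ↔ (k, l) ∉ P ∧ (l, k) ∉ P) ∧ v k ≠ v l := by
    intro k l hkl
    rcases lt_trichotomy k l with h | rfl | h
    · refine ⟨?_, (hv k l h).1⟩
      rw [← T.fwd_of_lt hkl, (hv k l h).2]
      exact ⟨fun h' => ⟨h', fun h'' => (hP _ h'').not_gt h⟩, fun h' => h'.1⟩
    · exact absurd hkl (lt_irrefl _)
    · refine ⟨?_, (hv l k h).1.symm⟩
      rw [← T.fwd_of_gt (i := β l) hkl, (hv l k h).2]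
      exact ⟨fun h' => ⟨fun h'' => (hP _ h'').not_gt h, h'⟩, fun h' => h'.2⟩
  refine T.contains_of_map H (fun i => v (τ (σ i))) fun i j hij => ?_
  rcases hσ i j hij with ⟨h, h'⟩ | ⟨h, h'⟩
  · exact (key _ _ (hτ h)).1.2 h'
  · obtain ⟨h1, h2⟩ := key _ _ (hτ h)
    refine T.adj_of_not_adj h2 fun h3 => ?_
    have := h1.1 h3
    tauto

end Layers

end Tournament

namespace Tournament

open Finset
open scoped Classical

/-! ### Finding the patterns in a layered tournament -/

section Layered

variable {V : Type*} (T : Tournament V)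

/-- Fifteen disjoint layers in which almost all arcs at every vertex are forward, the layers
`2, …, 10` being completely joined forward, while large parts of two layers that are not both among
these are never completely joined forward. -/
structure Layered (B : ℕ → Finset V) : Prop where
  nonempty : ∀ i < 15, (B i).Nonempty
  ne : ∀ i < 15, ∀ j < 15, i ≠ j → ∀ x ∈ B i, ∀ y ∈ B j, x ≠ y
  smooth : ∀ i < 15, ∀ j < 15, i ≠ j → ∀ x ∈ B i,
    20 * #{y ∈ B j | ¬ T.Fwd i j x y} ≤ #(B j)
  complete : ∀ i j, 2 ≤ i → i < j → j ≤ 10 → ∀ x ∈ B i, ∀ y ∈ B j, T.Adj x y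
  cross : ∀ i < 15, ∀ j < 15, i ≠ j → ¬ (2 ≤ i ∧ i ≤ 10 ∧ 2 ≤ j ∧ j ≤ 10) →
    ∀ Y ⊆ B i, ∀ Z ⊆ B j, #(B i) ≤ 8 * #Y → #(B j) ≤ 8 * #Z → ∃ y ∈ Y, ∃ z ∈ Z, ¬ T.Fwd i j y z

variable {T} {B : ℕ → Finset V}

/-- The vertices of a layer that are joined forward to all of `k` given vertices. -/
theorem Layered.card_common (hB : T.Layered B) {j : ℕ} (hj : j < 15) {k : ℕ} (v : Fin k → V)
    (β : Fin k → ℕ) (hβ : ∀ p, β p < 15 ∧ β p ≠ j ∧ v p ∈ B (β p)) :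
    20 * #(B j) ≤ 20 * #{y ∈ B j | ∀ p, T.Fwd (β p) j (v p) y} + k * #(B j) := by
  have h1 : B j ⊆ {y ∈ B j | ∀ p, T.Fwd (β p) j (v p) y} ∪
      (univ : Finset (Fin k)).biUnion fun p => {y ∈ B j | ¬ T.Fwd (β p) j (v p) y} := by
    intro y hy
    by_cases h : ∀ p, T.Fwd (β p) j (v p) y
    · simp [hy, h]
    · push Not at h
      simp [hy, h]
  have h2 := (card_le_card h1).trans (card_union_le _ _)
  have h3 : #((univ : Finset (Fin k)).biUnion fun p => {y ∈ B j | ¬ T.Fwd (β p) j (v p) y}) ≤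
      ∑ p : Fin k, #{y ∈ B j | ¬ T.Fwd (β p) j (v p) y} := card_biUnion_le
  have h4 : 20 * ∑ p : Fin k, #{y ∈ B j | ¬ T.Fwd (β p) j (v p) y} ≤ k * #(B j) := by
    rw [mul_sum]
    refine (sum_le_card_nsmul _ _ (#(B j)) fun p _ =>
      hB.smooth _ (hβ p).1 _ hj (hβ p).2.1 _ (hβ p).2.2).trans ?_
    simp
  omega

/-- Few vertices of a layer are completely joined forward to a large part of another layer. -/
theorem Layered.card_unjoined (hB : T.Layered B) {i j : ℕ} (hi : i < 15) (hj : j < 15)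
    (hij : i ≠ j) (hc : ¬ (2 ≤ i ∧ i ≤ 10 ∧ 2 ≤ j ∧ j ≤ 10)) {Z : Finset V} (hZ : Z ⊆ B j)
    (hZc : #(B j) ≤ 8 * #Z) : 8 * #{y ∈ B i | ∀ z ∈ Z, T.Fwd i j y z} < #(B i) := by
  by_contra! h
  obtain ⟨y, hy, z, hz, hyz⟩ := hB.cross i hi j hj hij hc _ (filter_subset _ _) Z hZ h hZc
  exact hyz ((mem_filter.1 hy).2 z hz)

/-- A backward pair `a, e` in the layers `0` and `13`, each with backward neighbours in the layers
`3`, `6` and `9`. -/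
theorem Layered.exists_pair (hB : T.Layered B) : ∃ a ∈ B 0, ∃ e ∈ B 13, ¬ T.Fwd 0 13 a e ∧
    ∀ s, s = 3 ∨ s = 6 ∨ s = 9 → (∃ x ∈ B s, ¬ T.Fwd 0 s a x) ∧ ∃ x ∈ B s, ¬ T.Fwd 13 s e x := by
  -- Each of the three layers rules out less than 1/8 of `B i`, so more than 5/8 is left; `cross`
  -- needs only 1/8.
  have key : ∀ i, i = 0 ∨ i = 13 →
      #(B i) ≤ 8 * #{y ∈ B i | ∀ s, s = 3 ∨ s = 6 ∨ s = 9 → ∃ x ∈ B s, ¬ T.Fwd i s y x} := by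
    intro i hi
    have h (s : ℕ) (hs : s = 3 ∨ s = 6 ∨ s = 9) :=
      hB.card_unjoined (i := i) (j := s) (by omega) (by omega) (by omega) (by omega)
        (Subset.refl _) (by omega)
    have h3 := h 3 (by simp)
    have h6 := h 6 (by simp)
    have h9 := h 9 (by simp)
    have hsub : B i ⊆ {y ∈ B i | ∀ s, s = 3 ∨ s = 6 ∨ s = 9 → ∃ x ∈ B s, ¬ T.Fwd i s y x} ∪
        ({y ∈ B i | ∀ z ∈ B 3, T.Fwd i 3 y z} ∪ ({y ∈ B i | ∀ z ∈ B 6, T.Fwd i 6 y z} ∪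
          {y ∈ B i | ∀ z ∈ B 9, T.Fwd i 9 y z})) := by
      intro y hy
      simp only [mem_union, mem_filter, hy, true_and]
      by_contra! hcon
      obtain ⟨⟨s, hs, h1⟩, ⟨x3, h3, h3'⟩, ⟨x6, h6, h6'⟩, x9, h9, h9'⟩ := hcon
      rcases hs with rfl | rfl | rfl
      · exact h3' (h1 _ h3)
      · exact h6' (h1 _ h6)
      · exact h9' (h1 _ h9)
    have h1 := card_le_card hsub
    have h2 := card_union_le {y ∈ B i | ∀ s, s = 3 ∨ s = 6 ∨ s = 9 → ∃ x ∈ B s, ¬ T.Fwd i s y x}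
        ({y ∈ B i | ∀ z ∈ B 3, T.Fwd i 3 y z} ∪ ({y ∈ B i | ∀ z ∈ B 6, T.Fwd i 6 y z} ∪
          {y ∈ B i | ∀ z ∈ B 9, T.Fwd i 9 y z}))
    have h4 := card_union_le {y ∈ B i | ∀ z ∈ B 3, T.Fwd i 3 y z}
      ({y ∈ B i | ∀ z ∈ B 6, T.Fwd i 6 y z} ∪ {y ∈ B i | ∀ z ∈ B 9, T.Fwd i 9 y z})
    have h5 := card_union_le {y ∈ B i | ∀ z ∈ B 6, T.Fwd i 6 y z}
      {y ∈ B i | ∀ z ∈ B 9, T.Fwd i 9 y z}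
    omega
  obtain ⟨a, ha, e, he, hae⟩ := hB.cross 0 (by omega) 13 (by omega) (by omega) (by omega)
    _ (filter_subset _ _) _ (filter_subset _ _) (key 0 (by simp)) (key 13 (by simp))
  rw [mem_filter] at ha he
  exact ⟨a, ha.1, e, he.1, hae, fun s hs => ⟨ha.2 s hs, he.2 s hs⟩⟩

/-- The backward star with centre `z` and leaves `f`, `g`, and one further vertex `w`, that extend
four given vertices by forward arcs. -/
theorem Layered.exists_extension (hB : T.Layered B) (v : Fin 4 → V) (β : Fin 4 → ℕ)
    (hv : ∀ p, β p < 15 ∧ v p ∈ B (β p)) {c l m r : ℕ} (hc : c < 15) (hc' : c < 2 ∨ 10 < c)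
    (hl : 2 ≤ l ∧ l ≤ 10) (hm : 2 ≤ m ∧ m ≤ 10) (hr : r < 15) (hlm : l ≠ m)
    (hrc : r ≠ c) (hrl : r ≠ l) (hrm : r ≠ m)
    (hβ : ∀ p, β p ≠ c ∧ β p ≠ l ∧ β p ≠ m ∧ β p ≠ r) :
    ∃ z ∈ B c, ∃ f ∈ B l, ∃ g ∈ B m, ∃ w ∈ B r,
      (∀ p, T.Fwd (β p) c (v p) z ∧ T.Fwd (β p) l (v p) f ∧ T.Fwd (β p) m (v p) g ∧
        T.Fwd (β p) r (v p) w) ∧ ¬ T.Fwd c l z f ∧ ¬ T.Fwd c m z g ∧ T.Fwd l m f g ∧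
      T.Fwd c r z w ∧ T.Fwd l r f w ∧ T.Fwd m r g w := by
  -- Four given vertices spoil at most 4/20 of a layer; the remaining 4/5 exceeds the 1/8 needed for
  -- `card_unjoined`.
  have hcz := hB.card_common hc v β fun p => ⟨(hv p).1, (hβ p).1, (hv p).2⟩
  have hcf := hB.card_common (j := l) (by omega) v β fun p => ⟨(hv p).1, (hβ p).2.1, (hv p).2⟩
  have hcg := hB.card_common (j := m) (by omega) v β fun p => ⟨(hv p).1, (hβ p).2.2.1, (hv p).2⟩
  have h1 := hB.card_unjoined (i := c) (j := l) hc (by omega) (by omega) (by omega)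
    (filter_subset (fun y => ∀ p, T.Fwd (β p) l (v p) y) (B l)) (by omega)
  have h2 := hB.card_unjoined (i := c) (j := m) hc (by omega) (by omega) (by omega)
    (filter_subset (fun y => ∀ p, T.Fwd (β p) m (v p) y) (B m)) (by omega)
  -- The vertices of `B c` with no backward neighbour in one of the two remaining sets make up less
  -- than 2/8 of `B c`, against 4/5 available.
  obtain ⟨z, hz, hzn⟩ : ∃ z ∈ ({y ∈ B c | ∀ p, T.Fwd (β p) c (v p) y} : Finset V), z ∉
      {y ∈ B c | ∀ z ∈ ({y ∈ B l | ∀ p, T.Fwd (β p) l (v p) y} : Finset V), T.Fwd c l y z} ∪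
      {y ∈ B c | ∀ z ∈ ({y ∈ B m | ∀ p, T.Fwd (β p) m (v p) y} : Finset V), T.Fwd c m y z} := by
    refine exists_mem_notMem_of_card_lt_card ((card_union_le _ _).trans_lt ?_)
    omega
  rw [mem_filter] at hz
  simp only [mem_union, mem_filter, hz.1, true_and, not_or] at hzn
  push Not at hzn
  obtain ⟨⟨f, ⟨hf, hf'⟩, hzf⟩, g, ⟨hg, hg'⟩, hzg⟩ := hzn
  have hfg : T.Fwd l m f g := by
    rcases lt_or_gt_of_ne hlm with h | h
    · rw [T.fwd_of_lt h]
      exact hB.complete _ _ hl.1 h hm.2 _ hf _ hg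
    · rw [T.fwd_of_gt h]
      exact hB.complete _ _ hm.1 h hl.2 _ hg _ hf
  -- Seven vertices now spoil at most 7/20 of the layer of w.
  have hw := hB.card_common hr (Fin.append v ![z, f, g]) (Fin.append β ![c, l, m]) (by
    intro p
    refine Fin.addCases (fun p => ?_) (fun p => ?_) p
    · simpa using ⟨(hv p).1, (hβ p).2.2.2, (hv p).2⟩
    · rw [Fin.append_right, Fin.append_right]
      fin_cases p
      · exact ⟨hc, hrc.symm, hz.1⟩
      · exact ⟨show l < 15 by omega, hrl.symm, hf⟩
      · exact ⟨show m < 15 by omega, hrm.symm, hg⟩)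
  have hpos := (hB.nonempty r hr).card_pos
  obtain ⟨w, hw⟩ := card_pos.1 (show 0 < #{y ∈ B r | ∀ p, T.Fwd (Fin.append β ![c, l, m] p) r
    (Fin.append v ![z, f, g] p) y} by omega)
  rw [mem_filter] at hw
  have hwr : ∀ q : Fin 3, T.Fwd (![c, l, m] q) r (![z, f, g] q) w := fun q => by
    have := hw.2 (Fin.natAdd 4 q)
    rwa [Fin.append_right, Fin.append_right] at this
  refine ⟨z, hz.1, f, hf, g, hg, w, hw.1, fun p => ⟨hz.2 p, hf' p, hg' p, ?_⟩, hzf, hzg, hfg,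
    hwr 0, hwr 1, hwr 2⟩
  simpa using hw.2 (Fin.castAdd 3 p)

/-- Wherever `x` and `y` are chosen in the layers `s` and `t`, there are layers for the other
labels in which the order of the labels `τ` is the order of the layers. -/
def IsAdmissible (τ : Fin 7 → Fin 8) : Prop :=
  ∀ s t, 3 ≤ s → s + 3 ≤ t → t ≤ 9 → ∃ c l m r : ℕ, c < 15 ∧ (c < 2 ∨ 10 < c) ∧
    (2 ≤ l ∧ l ≤ 10) ∧ (2 ≤ m ∧ m ≤ 10) ∧ r < 15 ∧ [0, 13, s, t, c, l, m, r].Nodup ∧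
    StrictMono (![0, 13, s, t, c, l, m, r] ∘ τ)

/-- Only the arcs of the core distinguish the two kinds of pattern. Once they are prescribed,
`exists_extension` provides every arc at z, f, g, w, and `hP'` says that P asks there for exactly
the backward pairs zf and zg. -/
theorem Layered.contains_of_core (hB : T.Layered B) {P : Finset (Fin 8 × Fin 8)}
    {τ : Fin 7 → Fin 8} {H : Tournament (Fin 7)} (hH : IsPattern P τ H) (hτ : IsAdmissible τ)
    (hP : ∀ p ∈ P, p.1 < p.2)
    (hP' : ∀ k l : Fin 8, 4 ≤ l → ((k, l) ∈ P ↔ (k, l) = (4, 5) ∨ (k, l) = (4, 6)))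
    {s t : ℕ} (hs : 3 ≤ s) (hst : s + 3 ≤ t) (ht : t ≤ 9) {a e x y : V} (ha : a ∈ B 0)
    (he : e ∈ B 13) (hx : x ∈ B s) (hy : y ∈ B t)
    (hae : T.Fwd 0 13 a e ↔ ((0, 1) : Fin 8 × Fin 8) ∉ P)
    (hax : T.Fwd 0 s a x ↔ ((0, 2) : Fin 8 × Fin 8) ∉ P)
    (hay : T.Fwd 0 t a y ↔ ((0, 3) : Fin 8 × Fin 8) ∉ P)
    (hex : T.Fwd 13 s e x ↔ ((1, 2) : Fin 8 × Fin 8) ∉ P)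
    (hey : T.Fwd 13 t e y ↔ ((1, 3) : Fin 8 × Fin 8) ∉ P)
    (hxy : ((2, 3) : Fin 8 × Fin 8) ∉ P) : T.Contains H := by
  obtain ⟨c, l, m, r, hc, hc', hl, hm, hr, hnd, hmono⟩ := hτ s t hs hst ht
  have hinj : Function.Injective ![0, 13, s, t, c, l, m, r] :=
    List.nodup_ofFn.1 (by simpa using hnd)
  have hne : ∀ p q, p ≠ q → ![0, 13, s, t, c, l, m, r] p ≠ ![0, 13, s, t, c, l, m, r] q :=
    fun p q hpq h => hpq (hinj h)
  obtain ⟨z, hz, f, hf, g, hg, w, hw, hall, hzf, hzg, hfg, hzw, hfw, hgw⟩ :=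
    hB.exists_extension ![a, e, x, y] ![0, 13, s, t] (c := c) (l := l) (m := m) (r := r)
      (by
        intro p
        fin_cases p
        · exact ⟨by norm_num, ha⟩
        · exact ⟨by norm_num, he⟩
        · exact ⟨show s < 15 by omega, hx⟩
        · exact ⟨show t < 15 by omega, hy⟩)
      hc hc' hl hm hr (hne 5 6 (by decide)) (hne 7 4 (by decide)) (hne 7 5 (by decide))
      (hne 7 6 (by decide))
      (by
        intro p
        fin_cases p
        · exact ⟨hne 0 4 (by decide), hne 0 5 (by decide), hne 0 6 (by decide), hne 0 7 (by decide)⟩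
        · exact ⟨hne 1 4 (by decide), hne 1 5 (by decide), hne 1 6 (by decide), hne 1 7 (by decide)⟩
        · exact ⟨hne 2 4 (by decide), hne 2 5 (by decide), hne 2 6 (by decide), hne 2 7 (by decide)⟩
        · exact ⟨hne 3 4 (by decide), hne 3 5 (by decide), hne 3 6 (by decide),
            hne 3 7 (by decide)⟩)
  have hmem : ∀ k, ![0, 13, s, t, c, l, m, r] k < 15 ∧
      ![a, e, x, y, z, f, g, w] k ∈ B (![0, 13, s, t, c, l, m, r] k) := by
    intro k
    fin_cases k
    · exact ⟨by norm_num, ha⟩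
    · exact ⟨by norm_num, he⟩
    · exact ⟨show s < 15 by omega, hx⟩
    · exact ⟨show t < 15 by omega, hy⟩
    · exact ⟨hc, hz⟩
    · exact ⟨show l < 15 by omega, hf⟩
    · exact ⟨show m < 15 by omega, hg⟩
    · exact ⟨hr, hw⟩
  have hfwd : T.Fwd s t x y := by
    rw [T.fwd_of_lt (by omega)]
    exact hB.complete s t (by omega) (by omega) (by omega) _ hx _ hy
  obtain ⟨h04, h05, h06, h07⟩ := hall 0
  obtain ⟨h14, h15, h16, h17⟩ := hall 1
  obtain ⟨h24, h25, h26, h27⟩ := hall 2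
  obtain ⟨h34, h35, h36, h37⟩ := hall 3
  refine T.contains_of_isPattern hH ![0, 13, s, t, c, l, m, r] ![a, e, x, y, z, f, g, w] hmono
    (fun k l hkl => ⟨hB.ne _ (hmem k).1 _ (hmem l).1 (fun h => hkl.ne (hinj h)) _ (hmem k).2 _
      (hmem l).2, ?_⟩) hP
  clear hmono hinj hmem hall hnd hne
  by_cases h4 : 4 ≤ l
  · rw [hP' k l h4]
    clear hP' hP hH hB
    fin_cases k <;> fin_cases l <;> first
      | exact absurd hkl (by decide)
      | exact absurd h4 (by decide)
      | exact iff_of_true (by assumption) (by decide)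
      | exact iff_of_false (by assumption) (by decide)
  · clear hP' hP hH hB
    fin_cases k <;> fin_cases l <;> first
      | exact absurd hkl (by decide)
      | exact absurd (by decide) h4
      | assumption
      | exact iff_of_true hfwd hxy

/-- In a layered tournament, one of two tournaments following a path pattern and a triangle
pattern is found. -/
theorem Layered.contains_or_contains (hB : T.Layered B) {τ τ' : Fin 7 → Fin 8}
    {H H' : Tournament (Fin 7)} (hH : IsPattern pathPairs τ H) (hτ : IsAdmissible τ)
    (hH' : IsPattern trianglePairs τ' H') (hτ' : IsAdmissible τ') :
    T.Contains H ∨ T.Contains H' := by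
  obtain ⟨a, ha, e, he, hae, hs⟩ := hB.exists_pair
  have main : ∀ s t, (s = 3 ∨ s = 6 ∨ s = 9) → (t = 3 ∨ t = 6 ∨ t = 9) → s < t →
      ((∃ x ∈ B s, ¬ T.Fwd 0 s a x ∧ ¬ T.Fwd 13 s e x) ↔
        (∃ x ∈ B t, ¬ T.Fwd 0 t a x ∧ ¬ T.Fwd 13 t e x)) → T.Contains H ∨ T.Contains H' := by
    intro s t hs' ht' hst hiff
    by_cases h : ∃ x ∈ B s, ¬ T.Fwd 0 s a x ∧ ¬ T.Fwd 13 s e x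
    · obtain ⟨y, hy, hay, hey⟩ := hiff.1 h
      obtain ⟨x, hx, hax, hex⟩ := h
      right
      refine hB.contains_of_core hH' hτ' (by decide) (by decide) (by omega) (by omega) (by omega)
        ha he hx hy ?_ ?_ ?_ ?_ ?_ (by decide)
      · exact iff_of_false hae (by decide)
      · exact iff_of_false hax (by decide)
      · exact iff_of_false hay (by decide)
      · exact iff_of_false hex (by decide)
      · exact iff_of_false hey (by decide)
    -- Without common backward neighbours, a backward neighbour x of e is automatically forward from
    -- a, and a backward neighbour y of a is forward to e: the path core.
    · have h' := hiff.not.1 h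
      push Not at h h'
      obtain ⟨x, hx, hex⟩ := (hs s hs').2
      obtain ⟨y, hy, hay⟩ := (hs t ht').1
      left
      refine hB.contains_of_core hH hτ (by decide) (by decide) (by omega) (by omega) (by omega)
        ha he hx hy ?_ ?_ ?_ ?_ ?_ (by decide)
      · exact iff_of_false hae (by decide)
      · exact iff_of_true (by_contra fun hax => hex (h x hx hax)) (by decide)
      · exact iff_of_false hay (by decide)
      · exact iff_of_false hex (by decide)
      · exact iff_of_true (h' y hy hay) (by decide)
  have h36 := main 3 6 (by simp) (by simp) (by norm_num)
  have h39 := main 3 9 (by simp) (by simp) (by norm_num)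
  have h69 := main 6 9 (by simp) (by simp) (by norm_num)
  -- Among three truth values two coincide.
  by_cases p3 : ∃ x ∈ B 3, ¬ T.Fwd 0 3 a x ∧ ¬ T.Fwd 13 3 e x <;>
    by_cases p6 : ∃ x ∈ B 6, ¬ T.Fwd 0 6 a x ∧ ¬ T.Fwd 13 6 e x <;>
    by_cases p9 : ∃ x ∈ B 9, ¬ T.Fwd 0 9 a x ∧ ¬ T.Fwd 13 9 e x <;>
    first
      | exact h36 (iff_of_true p3 p6)
      | exact h36 (iff_of_false p3 p6)
      | exact h39 (iff_of_true p3 p9)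
      | exact h39 (iff_of_false p3 p9)
      | exact h69 (iff_of_true p6 p9)
      | exact h69 (iff_of_false p6 p9)

end Layered

/-! ### Layers for the labels of each pattern -/

theorem isAdmissible_of_layers {τ : Fin 7 → Fin 8} (c l m r : ℕ → ℕ)
    (h : ∀ s t, 3 ≤ s → s + 3 ≤ t → t ≤ 9 → (c s < 15 ∧ (c s < 2 ∨ 10 < c s) ∧
    (2 ≤ l s ∧ l s ≤ 10) ∧ (2 ≤ m s ∧ m s ≤ 10) ∧ r s < 15 ∧
    [0, 13, s, t, c s, l s, m s, r s].Nodup ∧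
    ∀ i : Fin 6, ![0, 13, s, t, c s, l s, m s, r s] (τ i.castSucc) <
      ![0, 13, s, t, c s, l s, m s, r s] (τ i.succ))) : IsAdmissible τ := by
  intro s t hs hst ht
  obtain ⟨h1, h2, h3, h4, h5, h6, h7⟩ := h s t hs hst ht
  exact ⟨c s, l s, m s, r s, h1, h2, h3, h4, h5, h6, Fin.strictMono_iff_lt_succ.2 h7⟩

/-- As 3 ≤ s, s + 3 ≤ t and t ≤ 9, layer 2 is free below x, layers s + 1 and s + 2 between x and y,
and layer 10 above y. The centre z goes to layer 1, 11 or 14 according as it precedes x, lies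
between y and e, or follows e. An omitted label takes any spare layer. The same choices serve the
other patterns. -/
theorem isAdmissible_H14 : IsAdmissible ![0, 2, 5, 7, 3, 1, 4] := by
  refine isAdmissible_of_layers (fun _ => 14) (fun s => s + 1) (fun _ => 10) (fun s => s + 2) ?_
  intro s t hs hst ht
  simp [Fin.forall_fin_succ]
  omega

theorem isAdmissible_H42 : IsAdmissible ![0, 5, 2, 7, 3, 4, 1] := by
  refine isAdmissible_of_layers (fun _ => 11) (fun _ => 2) (fun _ => 10) (fun s => s + 1) ?_
  intro s t hs hst ht
  simp [Fin.forall_fin_succ]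
  omega

theorem isAdmissible_H5 : IsAdmissible ![0, 4, 2, 5, 3, 7, 1] := by
  refine isAdmissible_of_layers (fun _ => 1) (fun s => s + 1) (fun _ => 2) (fun _ => 10) ?_
  intro s t hs hst ht
  simp [Fin.forall_fin_succ]
  omega

theorem isAdmissible_H36 : IsAdmissible ![0, 5, 2, 6, 3, 4, 1] := by
  refine isAdmissible_of_layers (fun _ => 11) (fun _ => 2) (fun s => s + 1) (fun _ => 10) ?_
  intro s t hs hst ht
  simp [Fin.forall_fin_succ]
  omega

theorem isAdmissible_H22 : IsAdmissible ![0, 4, 2, 7, 5, 3, 1] := by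
  refine isAdmissible_of_layers (fun _ => 1) (fun s => s + 2) (fun _ => 10) (fun s => s + 1) ?_
  intro s t hs hst ht
  simp [Fin.forall_fin_succ]
  omega

theorem isAdmissible_H49 : IsAdmissible ![0, 4, 2, 7, 3, 5, 1] := by
  refine isAdmissible_of_layers (fun _ => 1) (fun _ => 10) (fun _ => 2) (fun s => s + 1) ?_
  intro s t hs hst ht
  simp [Fin.forall_fin_succ]
  omega

theorem isAdmissible_H24 : IsAdmissible ![0, 2, 5, 3, 7, 4, 1] := by
  refine isAdmissible_of_layers (fun _ => 11) (fun s => s + 1) (fun _ => 2) (fun _ => 10) ?_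
  intro s t hs hst ht
  simp [Fin.forall_fin_succ]
  omega

theorem isAdmissible_H19 : IsAdmissible ![0, 2, 5, 3, 4, 7, 1] := by
  refine isAdmissible_of_layers (fun _ => 11) (fun s => s + 1) (fun _ => 2) (fun _ => 12) ?_
  intro s t hs hst ht
  simp [Fin.forall_fin_succ]
  omega

end Tournament

namespace Tournament

open Finset
open scoped Classical

/-! ### Transitive sets -/

section TransitiveOn

variable {V : Type*} (T : Tournament V)

/-- The arcs inside `S` increase some rank function. -/
def TransitiveOn (S : Finset V) : Prop :=
  ∃ r : V → ℕ, ∀ x ∈ S, ∀ y ∈ S, T.Adj x y → r x < r y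

variable {T}

theorem TransitiveOn.isTransitive {S : Finset V} (hS : T.TransitiveOn S) :
    (T.induce (S : Set V)).IsTransitive := by
  obtain ⟨r, hr⟩ := hS
  have h : ∀ x y, Relation.TransGen (T.induce (S : Set V)).Adj x y → r x < r y := by
    intro x y hxy
    induction hxy with
    | single h => exact hr _ x.2 _ (Subtype.mem _) h
    | tail _ h ih => exact ih.trans (hr _ (Subtype.mem _) _ (Subtype.mem _) h)
  exact fun x hx => lt_irrefl _ (h x x hx)

theorem TransitiveOn.subset {S S' : Finset V} (hS : T.TransitiveOn S) (h : S' ⊆ S) :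
    T.TransitiveOn S' := by
  obtain ⟨r, hr⟩ := hS
  exact ⟨r, fun x hx y hy => hr x (h hx) y (h hy)⟩

theorem TransitiveOn.union {S S' : Finset V} (hS : T.TransitiveOn S) (hS' : T.TransitiveOn S')
    (h : ∀ x ∈ S, ∀ y ∈ S', T.Adj x y) : T.TransitiveOn (S ∪ S') := by
  obtain ⟨r, hr⟩ := hS
  obtain ⟨r', hr'⟩ := hS'
  -- The ranks on `S'` are shifted above all ranks on `S`.
  refine ⟨fun x => if x ∈ S then r x else r' x + S.sup r + 1, fun x hx y hy hxy => ?_⟩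
  have hsup : ∀ x ∈ S, r x ≤ S.sup r := fun x hx => le_sup hx
  by_cases hxS : x ∈ S <;> by_cases hyS : y ∈ S
  · simpa [hxS, hyS] using hr x hxS y hyS hxy
  · have := hsup x hxS
    simp only [hxS, hyS, if_true, if_false]
    omega
  · exact absurd hxy (T.not_adj_of_adj (h y hyS x ((mem_union.1 hx).resolve_left hxS)))
  · have := hr' x ((mem_union.1 hx).resolve_left hxS) y ((mem_union.1 hy).resolve_left hyS) hxy
    simp only [hxS, hyS, if_false]
    omega

theorem transitiveOn_singleton (x : V) : T.TransitiveOn {x} :=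
  ⟨fun _ => 0, fun y hy z hz h => by
    rw [mem_singleton] at hy hz
    subst hy hz
    exact absurd h (T.loopless _)⟩

/-- A transitive set has an initial segment of any given size. -/
theorem TransitiveOn.exists_initial {S : Finset V} (hS : T.TransitiveOn S) {m : ℕ}
    (hm : m ≤ #S) : ∃ D ⊆ S, #D = m ∧ ∀ x ∈ D, ∀ y ∈ S \ D, T.Adj x y := by
  obtain ⟨r, hr⟩ := hS
  induction m with
  | zero => exact ⟨∅, by simp⟩
  | succ m ih =>
    obtain ⟨D, hD, hDm, hDr⟩ := ih (by omega)
    have hne : (S \ D).Nonempty := by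
      rw [← card_pos, card_sdiff_of_subset hD]
      omega
    -- The initial segment grows by a remaining vertex of least rank.
    obtain ⟨x, hx, hmin⟩ := exists_min_image (S \ D) r hne
    have hx' := mem_sdiff.1 hx
    refine ⟨insert x D, insert_subset hx'.1 hD, by rw [card_insert_of_notMem hx'.2, hDm], ?_⟩
    intro y hy z hz
    simp only [mem_sdiff, mem_insert, not_or] at hz
    rcases mem_insert.1 hy with rfl | hy
    · by_contra h
      have h1 := hr z hz.1 y hx'.1 (T.adj_of_not_adj (Ne.symm hz.2.1) h)
      have h2 := hmin z (mem_sdiff.2 ⟨hz.1, hz.2.2⟩)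
      omega
    · exact hDr y hy z (mem_sdiff.2 ⟨hz.1, hz.2.2⟩)

/-- A transitive set with at least `k * m` vertices has `k` successive parts of size `m`. -/
theorem TransitiveOn.exists_parts (k : ℕ) {m : ℕ} {S : Finset V} (hS : T.TransitiveOn S)
    (hm : k * m ≤ #S) : ∃ C : ℕ → Finset V, (∀ i < k, C i ⊆ S ∧ #(C i) = m) ∧
      ∀ i j, i < j → j < k → ∀ x ∈ C i, ∀ y ∈ C j, T.Adj x y := by
  induction k generalizing S with
  | zero => exact ⟨fun _ => ∅, by simp⟩
  | succ k ih =>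
    rw [Nat.succ_mul] at hm
    obtain ⟨D, hD, hDm, hDS⟩ := hS.exists_initial (m := m) (by omega)
    obtain ⟨C, hC, hC'⟩ := ih (hS.subset (sdiff_subset (t := D)))
      (by rw [card_sdiff_of_subset hD]; omega)
    refine ⟨fun i => Nat.casesOn i D C, ?_, ?_⟩
    · rintro (_ | i) hi
      · exact ⟨hD, hDm⟩
      · exact ⟨(hC i (by omega)).1.trans sdiff_subset, (hC i (by omega)).2⟩
    · rintro (_ | i) (_ | j) hij hj x hx y hy
      · omega
      · exact hDS x hx y ((hC j (by omega)).1 hy)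
      · omega
      · exact hC' i j (by omega) (by omega) x hx y hy

/-- Every set of `2 ^ k` vertices has a transitive subset with `k + 1` vertices. -/
theorem exists_transitiveOn_of_two_pow_le (k : ℕ) (X : Finset V) (hX : 2 ^ k ≤ #X) :
    ∃ S ⊆ X, T.TransitiveOn S ∧ #S = k + 1 := by
  induction k generalizing X with
  | zero =>
    obtain ⟨x, hx⟩ := card_pos.1 (show 0 < #X by simpa using hX)
    exact ⟨{x}, by simpa using hx, transitiveOn_singleton x, by simp⟩
  | succ k ih =>
    have hpos : 0 < 2 ^ k := by positivity
    rw [pow_succ] at hX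
    obtain ⟨x, hx⟩ := card_pos.1 (show 0 < #X by omega)
    have hcard : #X ≤ #{y ∈ X | T.Adj x y} + #{y ∈ X | T.Adj y x} + 1 := by
      have : X ⊆ ({y ∈ X | T.Adj x y} ∪ {y ∈ X | T.Adj y x}) ∪ {x} := by
        intro y hy
        by_cases hxy : y = x
        · simp [hxy]
        · by_cases h : T.Adj x y
          · simp [hy, h]
          · simp [hy, T.adj_of_not_adj (Ne.symm hxy) h]
      refine (card_le_card this).trans ((card_union_le _ _).trans ?_)
      simpa using card_union_le _ _
    have hins : ∀ S : Finset V, x ∉ S → #(S ∪ {x}) = #S + 1 := fun S hS => by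
      rw [union_comm, ← insert_eq, card_insert_of_notMem hS]
    -- The in- and out-neighbourhoods of x in X have at least 2 ^ (k + 1) - 1 vertices together, so
    -- one has at least 2 ^ k.
    by_cases h : 2 ^ k ≤ #{y ∈ X | T.Adj y x}
    · obtain ⟨S, hS, hST, hSc⟩ := ih _ h
      refine ⟨S ∪ {x}, union_subset (hS.trans (filter_subset _ _)) (by simpa using hx),
        hST.union (transitiveOn_singleton x) fun y hy z hz => ?_, ?_⟩
      · rw [mem_singleton.1 hz]
        exact (mem_filter.1 (hS hy)).2
      · rw [hins _ fun h => T.loopless _ (mem_filter.1 (hS h)).2, hSc]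
    · obtain ⟨S, hS, hST, hSc⟩ := ih {y ∈ X | T.Adj x y} (by omega)
      refine ⟨{x} ∪ S, union_subset (by simpa using hx) (hS.trans (filter_subset _ _)),
        (transitiveOn_singleton x).union hST fun z hz y hy => ?_, ?_⟩
      · rw [mem_singleton.1 hz]
        exact (mem_filter.1 (hS hy)).2
      · rw [union_comm, hins _ fun h => T.loopless _ (mem_filter.1 (hS h)).2, hSc]

end TransitiveOn

/-! ### Sparse pairs and blocks -/

section Blocks

variable {V : Type*} (T : Tournament V)

/-- The number of arcs from `B` to `A`. -/
noncomputable def backCount (A B : Finset V) : ℕ := ∑ x ∈ A, #{y ∈ B | T.Adj y x}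

theorem backCount_eq (A B : Finset V) : T.backCount A B = ∑ y ∈ B, #{x ∈ A | T.Adj y x} :=
  sum_card_bipartiteAbove_eq_sum_card_bipartiteBelow fun x y => T.Adj y x

theorem backCount_mono {A A' B B' : Finset V} (hA : A ⊆ A') (hB : B ⊆ B') :
    T.backCount A B ≤ T.backCount A' B' :=
  (sum_le_sum fun _ _ => card_le_card (filter_subset_filter _ hB)).trans
    (sum_le_sum_of_subset hA)

/-- `B` is almost completely dominated by `A`. -/
def IsSparsePair (c : ℝ) (A B : Finset V) : Prop :=
  Disjoint A B ∧ (T.backCount A B : ℝ) ≤ c * #A * #B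

/-- Greedy embedding: vertices for a prescribed relation can be chosen in given disjoint sets,
unless two of these have large subsets that form a sparse pair. -/
theorem exists_embedding_or_sparsePair (h : ℕ) {c : ℝ} (hc : 0 < c) :
    ∃ κ : ℝ, 0 < κ ∧ ∀ {V : Type u} (T : Tournament V) (R : Fin h → Fin h → Prop) (m : ℝ)
      (U : Fin h → Finset V), 0 < m → (∀ i, m ≤ #(U i)) →
      (∀ i j, i ≠ j → Disjoint (U i) (U j)) →
      (∃ φ : Fin h → V, (∀ i, φ i ∈ U i) ∧ ∀ i j, i < j →
        (R i j → T.Adj (φ i) (φ j)) ∧ (¬ R i j → T.Adj (φ j) (φ i))) ∨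
      ∃ A B, (∃ i j, A ⊆ U i ∧ B ⊆ U j) ∧ κ * m ≤ #A ∧ κ * m ≤ #B ∧ T.IsSparsePair c A B := by
  induction h with
  | zero => exact ⟨1, one_pos, fun T R m U _ _ _ => Or.inl ⟨Fin.elim0, Fin.rec0, Fin.rec0⟩⟩
  | succ h ih =>
    obtain ⟨κ, hκ, ih⟩ := ih
    -- The first term comes from recursion inside neighbourhoods of size `c * m`, the second from a
    -- pigeonhole over the `h` remaining sets.
    refine ⟨min (κ * c) (1 / (h + 1)), by positivity, fun {V} T R m U hm hU hdisj => ?_⟩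
    let N : Fin h → V → Finset V := fun j v =>
      {u ∈ U j.succ | (R 0 j.succ → T.Adj v u) ∧ (¬ R 0 j.succ → T.Adj u v)}
    by_cases hex : ∃ v ∈ U 0, ∀ j, c * #(U j.succ) ≤ #(N j v)
    · obtain ⟨v, hv, hN⟩ := hex
      rcases ih T (fun i j => R i.succ j.succ) (c * m) (fun j => N j v) (by positivity)
        (fun j => (mul_le_mul_of_nonneg_left (hU _) hc.le).trans (hN j))
        (fun i j hij => (hdisj i.succ j.succ (by simpa using hij)).mono (filter_subset _ _)
          (filter_subset _ _)) with ⟨φ, hφ, hφR⟩ | ⟨A, B, ⟨i, j, hA, hB⟩, hAc, hBc, hAB⟩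
      · left
        refine ⟨Fin.cons v φ, fun i => ?_, fun i j hij => ?_⟩
        · cases i using Fin.cases with
          | zero => exact hv
          | succ i => simpa using filter_subset _ _ (hφ i)
        · cases j using Fin.cases with
          | zero => exact absurd hij (Fin.not_lt_zero _)
          | succ j =>
            cases i using Fin.cases with
            | zero => simpa using (mem_filter.1 (hφ j)).2
            | succ i => simpa using hφR i j (by simpa using hij)
      · right
        have hle : min (κ * c) (1 / (h + 1)) * m ≤ κ * (c * m) := by
          rw [← mul_assoc]
          exact mul_le_mul_of_nonneg_right (min_le_left _ _) hm.le
        exact ⟨A, B, ⟨_, _, hA.trans (filter_subset _ _), hB.trans (filter_subset _ _)⟩,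
          hle.trans hAc, hle.trans hBc, hAB⟩
    · right
      push Not at hex
      have hUpos : 0 < #(U 0) := by
        have : (0 : ℝ) < #(U 0) := hm.trans_le (hU 0)
        exact_mod_cast this
      -- Every vertex of `U 0` fails for some later set, so a fraction 1/h of them fails for the
      -- same one.
      obtain ⟨j, hj⟩ : ∃ j : Fin h, (#(U 0) : ℝ) ≤
          h * #{v ∈ U 0 | (#(N j v) : ℝ) < c * #(U j.succ)} := by
        by_contra! hcon
        have h1 : (U 0) ⊆ (univ : Finset (Fin h)).biUnion fun j =>
            {v ∈ U 0 | (#(N j v) : ℝ) < c * #(U j.succ)} := by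
          intro v hv
          obtain ⟨j, hj⟩ := hex v hv
          simp only [mem_biUnion, mem_univ, true_and, mem_filter]
          exact ⟨j, hv, hj⟩
        have h2 : (#(U 0) : ℝ) ≤
            ∑ j : Fin h, (#{v ∈ U 0 | (#(N j v) : ℝ) < c * #(U j.succ)} : ℝ) := by
          exact_mod_cast (card_le_card h1).trans card_biUnion_le
        have hne : (univ : Finset (Fin h)).Nonempty := by
          obtain ⟨v, hv⟩ := card_pos.1 hUpos
          exact ⟨(hex v hv).choose, mem_univ _⟩
        have h3 : ∑ j : Fin h, (h : ℝ) * #{v ∈ U 0 | (#(N j v) : ℝ) < c * #(U j.succ)} <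
            ∑ _j : Fin h, (#(U 0) : ℝ) := sum_lt_sum_of_nonempty hne fun j _ => hcon j
        rw [← mul_sum, sum_const, card_univ, Fintype.card_fin, nsmul_eq_mul] at h3
        have := lt_of_mul_lt_mul_left h3 (Nat.cast_nonneg h)
        linarith
      set A : Finset V := {v ∈ U 0 | (#(N j v) : ℝ) < c * #(U j.succ)} with hA
      have hAsub : A ⊆ U 0 := filter_subset _ _
      have hAc : min (κ * c) (1 / (h + 1)) * m ≤ #A := by
        have h1 : (1 / (h + 1) : ℝ) * m ≤ #A := by
          have hh : (0 : ℝ) < h + 1 := by positivity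
          rw [div_mul_eq_mul_div, one_mul, div_le_iff₀ hh]
          have := hU 0
          have h0 : (0 : ℝ) ≤ #A := Nat.cast_nonneg _
          nlinarith
        exact (mul_le_mul_of_nonneg_right (min_le_right _ _) hm.le).trans h1
      have hBc : min (κ * c) (1 / (h + 1)) * m ≤ #(U j.succ) := by
        have h1 : (1 / (h + 1) : ℝ) ≤ 1 := by
          rw [div_le_one (by positivity)]
          linarith [Nat.cast_nonneg (α := ℝ) h]
        have h2 := mul_le_mul_of_nonneg_right ((min_le_right (κ * c) _).trans h1) hm.le
        linarith [hU j.succ]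
      have hd : Disjoint A (U j.succ) :=
        (hdisj 0 j.succ (Fin.succ_ne_zero j).symm).mono_left hAsub
      have hsum : ∑ v ∈ A, (#(N j v) : ℝ) ≤ c * #A * #(U j.succ) := by
        refine (sum_le_card_nsmul A _ (c * #(U j.succ)) fun v hv =>
          (mem_filter.1 hv).2.le).trans (le_of_eq ?_)
        rw [nsmul_eq_mul]
        ring
      -- The direction in which arcs are scarce decides the order of the sparse pair.
      by_cases hR : R 0 j.succ
      · refine ⟨U j.succ, A, ⟨_, _, Subset.refl _, hAsub⟩, hBc, hAc, hd.symm, ?_⟩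
        rw [backCount_eq, Nat.cast_sum]
        simp only [N, hR, not_true, false_imp_iff, and_true, true_imp_iff] at hsum
        linarith
      · refine ⟨A, U j.succ, ⟨_, _, hAsub, Subset.refl _⟩, hAc, hBc, hd, ?_⟩
        rw [backCount, Nat.cast_sum]
        simp only [N, hR, not_false_iff, false_imp_iff, true_and, true_imp_iff] at hsum
        exact hsum

theorem exists_disjoint_family (k : ℕ) {m : ℕ} {X : Finset V} (hm : k * m ≤ #X) :
    ∃ U : Fin k → Finset V, (∀ i, U i ⊆ X ∧ #(U i) = m) ∧
      ∀ i j, i ≠ j → Disjoint (U i) (U j) := by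
  induction k generalizing X with
  | zero => exact ⟨Fin.elim0, Fin.rec0, Fin.rec0⟩
  | succ k ih =>
    rw [Nat.succ_mul] at hm
    obtain ⟨D, hD, hDm⟩ := exists_subset_card_eq (show m ≤ #X by omega)
    obtain ⟨U, hU, hU'⟩ := ih (X := X \ D) (by rw [card_sdiff_of_subset hD]; omega)
    have hDU : ∀ i, Disjoint D (U i) := fun i => disjoint_sdiff.mono_right (hU i).1
    refine ⟨Fin.cons D U, fun i => ?_, fun i j hij => ?_⟩
    · cases i using Fin.cases with
      | zero => exact ⟨hD, hDm⟩
      | succ i => exact ⟨(hU i).1.trans sdiff_subset, (hU i).2⟩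
    · cases i using Fin.cases with
      | zero =>
        cases j using Fin.cases with
        | zero => exact absurd rfl hij
        | succ j => exact hDU j
      | succ i =>
        cases j using Fin.cases with
        | zero => exact (hDU i).symm
        | succ j => exact hU' i j (by simpa using hij)

/-- A large set in a tournament that does not contain `H` has large subsets that form a sparse
pair. -/
theorem exists_sparsePair {h : ℕ} (H : Tournament (Fin h)) {c : ℝ} (hc : 0 < c) :
    ∃ κ : ℝ, 0 < κ ∧ ∃ N : ℕ, ∀ {V : Type u} (T : Tournament V), ¬ T.Contains H →
      ∀ X : Finset V, N ≤ #X → ∃ A ⊆ X, ∃ B ⊆ X, κ * #X ≤ #A ∧ κ * #X ≤ #B ∧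
        T.IsSparsePair c A B := by
  obtain ⟨κ, hκ, hemb⟩ := exists_embedding_or_sparsePair.{u} h hc
  -- The parts have size `#X / (h + 1)`, also meaningful for h = 0; the factor 2 pays for rounding
  -- down.
  refine ⟨κ / (2 * (h + 1)), by positivity, h + 1, fun {V} T hT X hX => ?_⟩
  have hdiv : (h + 1) * (#X / (h + 1)) ≤ #X := Nat.mul_div_le _ _
  have hm1 : 1 ≤ #X / (h + 1) := (Nat.one_le_div_iff (by omega)).2 hX
  obtain ⟨U, hU, hU'⟩ := exists_disjoint_family h (m := #X / (h + 1)) (X := X)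
    ((Nat.mul_le_mul_right _ (Nat.le_succ h)).trans hdiv)
  have hle : κ / (2 * (h + 1)) * #X ≤ κ * (#X / (h + 1) : ℕ) := by
    have h1 : #X ≤ 2 * (h + 1) * (#X / (h + 1)) := by
      have := Nat.lt_mul_div_succ #X (show 0 < h + 1 by omega)
      nlinarith
    have h2 : (#X : ℝ) ≤ 2 * (h + 1) * (#X / (h + 1) : ℕ) := by exact_mod_cast h1
    rw [div_mul_eq_mul_div, div_le_iff₀ (by positivity)]
    nlinarith
  rcases hemb T H.Adj (#X / (h + 1) : ℕ) U (by exact_mod_cast hm1)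
    (fun i => by rw [(hU i).2]) hU' with ⟨φ, -, hφ⟩ | ⟨A, B, ⟨i, j, hA, hB⟩, hAc, hBc, hAB⟩
  · refine absurd (T.contains_of_map H φ fun i j hij => ?_) hT
    rcases lt_or_gt_of_ne (H.ne_of_adj hij) with h | h
    · exact (hφ i j h).1 hij
    · exact (hφ j i h).2 (H.not_adj_of_adj hij)
  · exact ⟨A, hA.trans (hU i).1, B, hB.trans (hU j).1, hle.trans hAc, hle.trans hBc, hAB⟩

/-- A large set in a tournament that does not contain `H` has any given number of large subsets,
every two of which, in order, form a sparse pair. -/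
theorem exists_blocks {h : ℕ} (H : Tournament (Fin h)) {c : ℝ} (hc : 0 < c)
    (k : ℕ) : ∃ κ : ℝ, 0 < κ ∧ ∃ N : ℕ, ∀ {V : Type u} (T : Tournament V), ¬ T.Contains H →
      ∀ X : Finset V, N ≤ #X → ∃ B : ℕ → Finset V, (∀ i < k, B i ⊆ X ∧ κ * #X ≤ #(B i)) ∧
        ∀ i j, i < j → j < k → T.IsSparsePair c (B i) (B j) := by
  induction k with
  | zero => exact ⟨1, one_pos, 0, fun _ _ _ _ => ⟨fun _ => ∅, by simp⟩⟩
  | succ k ih =>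
    obtain ⟨κ, hκ, N, ih⟩ := ih
    -- The extra factor in the sparsity compensates for later shrinking `Y` to a block of proportion
    -- κ.
    obtain ⟨κ', hκ', N', hpair⟩ := exists_sparsePair.{u} H (c := c * min κ 1) (by positivity)
    refine ⟨min κ' (κ * κ'), by positivity, max N' ⌈N / κ'⌉₊, fun {V} T hT X hX => ?_⟩
    obtain ⟨A, hA, Y, hY, hAc, hYc, hdisj, hback⟩ := hpair T hT X ((le_max_left _ _).trans hX)
    have hNY : N ≤ #Y := by
      have h1 : (N / κ' : ℝ) ≤ #X := (Nat.le_ceil _).trans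
        (by exact_mod_cast (le_max_right _ _).trans hX)
      rw [div_le_iff₀ hκ'] at h1
      have : (N : ℝ) ≤ #Y := by linarith
      exact_mod_cast this
    obtain ⟨B, hB, hB'⟩ := ih T hT Y hNY
    refine ⟨fun i => Nat.casesOn i A B, ?_, ?_⟩
    · rintro (_ | i) hi
      · exact ⟨hA, (mul_le_mul_of_nonneg_right (min_le_left _ _) (Nat.cast_nonneg _)).trans hAc⟩
      · refine ⟨(hB i (by omega)).1.trans hY, ?_⟩
        calc min κ' (κ * κ') * (#X : ℝ) ≤ κ * κ' * #X :=
              mul_le_mul_of_nonneg_right (min_le_right _ _) (Nat.cast_nonneg _)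
          _ = κ * (κ' * #X) := by ring
          _ ≤ κ * #Y := mul_le_mul_of_nonneg_left hYc hκ.le
          _ ≤ #(B i) := (hB i (by omega)).2
    · rintro (_ | i) (_ | j) hij hj
      · omega
      · obtain ⟨h1, h2⟩ := hB j (by omega)
        refine ⟨hdisj.mono_right h1, ?_⟩
        have h3 : (T.backCount A (B j) : ℝ) ≤ T.backCount A Y := by
          exact_mod_cast T.backCount_mono (Subset.refl A) h1
        calc (T.backCount A (B j) : ℝ) ≤ c * min κ 1 * #A * #Y := h3.trans hback
          _ = c * #A * (min κ 1 * #Y) := by ring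
          _ ≤ c * #A * #(B j) := by
            refine mul_le_mul_of_nonneg_left ?_ (by positivity)
            exact (mul_le_mul_of_nonneg_right (min_le_left _ _) (Nat.cast_nonneg _)).trans h2
      · omega
      · exact hB' i j (by omega) (by omega)

/-- Passing to half of every block, all vertices have few backward arcs to every other block. -/
theorem exists_smooth_blocks {k : ℕ} {c μ : ℝ} (hμ : 0 < μ) (hcμ : 4 * k * c ≤ μ)
    (B : ℕ → Finset V) (hB : ∀ i j, i < j → j < k → T.IsSparsePair c (B i) (B j)) :
    ∃ B' : ℕ → Finset V, (∀ i < k, B' i ⊆ B i ∧ #(B i) ≤ 2 * #(B' i)) ∧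
      ∀ i < k, ∀ j < k, i ≠ j → ∀ x ∈ B' i, (#{y ∈ B' j | ¬ T.Fwd i j x y} : ℝ) ≤ μ * #(B' j) := by
  have hcount : ∀ i < k, ∀ j < k, i ≠ j →
      (∑ x ∈ B i, #{y ∈ B j | ¬ T.Fwd i j x y} : ℝ) ≤ c * #(B i) * #(B j) := by
    intro i hi j hj hij
    rcases lt_or_gt_of_ne hij with h | h
    · obtain ⟨h1, h2⟩ := hB i j h hj
      refine le_trans ?_ h2
      rw [backCount, Nat.cast_sum]
      refine sum_le_sum fun x hx => Nat.cast_le.2 (card_le_card fun y hy => ?_)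
      rw [mem_filter, T.fwd_of_lt h] at hy
      exact mem_filter.2 ⟨hy.1, T.adj_of_not_adj (disjoint_iff_ne.1 h1 x hx y hy.1) hy.2⟩
    · obtain ⟨h1, h2⟩ := hB j i h hi
      refine le_trans ?_ (h2.trans (le_of_eq (by ring)))
      rw [backCount_eq, Nat.cast_sum]
      refine sum_le_sum fun x hx => Nat.cast_le.2 (card_le_card fun y hy => ?_)
      rw [mem_filter, T.fwd_of_gt h] at hy
      exact mem_filter.2 ⟨hy.1, T.adj_of_not_adj (disjoint_iff_ne.1 h1 y hy.1 x hx) hy.2⟩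
  let bad : ℕ → ℕ → Finset V := fun i j =>
    {x ∈ B i | μ / 2 * #(B j) < #{y ∈ B j | ¬ T.Fwd i j x y}}
  -- Markov's inequality: at most a fraction 2c/μ ≤ 1/(2k) of `B i` is bad towards `B j`, hence at
  -- most half is bad towards some j.
  have hbad : ∀ i < k, ∀ j < k, i ≠ j → (2 * k * #(bad i j) : ℝ) ≤ #(B i) := by
    intro i hi j hj hij
    have hk : (0 : ℝ) < k := by exact_mod_cast (by omega : 0 < k)
    rcases (Nat.cast_nonneg (α := ℝ) #(B j)).eq_or_lt' with h0 | hpos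
    · have : bad i j = ∅ := by
        have h0' : B j = ∅ := by simpa using h0
        simp [bad, h0']
      rw [this]
      simp
    · have h1 : (#(bad i j) : ℝ) * (μ / 2 * #(B j)) ≤ c * #(B i) * #(B j) := by
        refine le_trans ?_ (hcount i hi j hj hij)
        refine le_trans ?_ (sum_le_sum_of_subset_of_nonneg (show bad i j ⊆ B i from
          filter_subset _ _) fun _ _ _ => Nat.cast_nonneg _)
        rw [← nsmul_eq_mul]
        exact card_nsmul_le_sum _ _ _ fun x hx => (mem_filter.1 hx).2.le
      have h2 : (#(bad i j) : ℝ) * (μ / 2) ≤ c * #(B i) := by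
        refine le_of_mul_le_mul_right ?_ hpos
        linarith
      have h3 : 4 * k * (c * #(B i)) ≤ μ * #(B i) := by
        have := mul_le_mul_of_nonneg_right hcμ (Nat.cast_nonneg (α := ℝ) #(B i))
        linarith
      have h4 : 4 * k * ((#(bad i j) : ℝ) * (μ / 2)) ≤ 4 * k * (c * #(B i)) :=
        mul_le_mul_of_nonneg_left h2 (by positivity)
      refine le_of_mul_le_mul_left ?_ hμ
      linarith
  have hB' : ∀ i < k, #(B i) ≤
      2 * #{x ∈ B i | ∀ j < k, i ≠ j → (#{y ∈ B j | ¬ T.Fwd i j x y} : ℝ) ≤ μ / 2 * #(B j)} := by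
    intro i hi
    have hk : (0 : ℝ) < k := by exact_mod_cast (by omega : 0 < k)
    have h1 : B i ⊆
        {x ∈ B i | ∀ j < k, i ≠ j → (#{y ∈ B j | ¬ T.Fwd i j x y} : ℝ) ≤ μ / 2 * #(B j)} ∪
        ((range k).erase i).biUnion fun j => bad i j := by
      intro x hx
      simp only [mem_union, mem_filter, hx, true_and, mem_biUnion, mem_erase, mem_range, bad]
      by_contra! hcon
      obtain ⟨⟨j, hj, hij, h2⟩, h3⟩ := hcon
      exact absurd (h3 j ⟨hij.symm, hj⟩) (not_le.2 h2)
    have h2 : (#(((range k).erase i).biUnion fun j => bad i j) : ℝ) * (2 * k) ≤ k * #(B i) := by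
      have h3 : (#(((range k).erase i).biUnion fun j => bad i j) : ℝ) ≤
          ∑ j ∈ (range k).erase i, (#(bad i j) : ℝ) := by exact_mod_cast card_biUnion_le
      have h4 : ∑ j ∈ (range k).erase i, (2 * k * #(bad i j) : ℝ) ≤
          ∑ j ∈ (range k).erase i, (#(B i) : ℝ) := sum_le_sum fun j hj => by
        simp only [mem_erase, mem_range] at hj
        exact hbad i hi j hj.2 (Ne.symm hj.1)
      rw [← mul_sum, sum_const, nsmul_eq_mul] at h4
      have h5 : (#((range k).erase i) : ℝ) ≤ k := by
        exact_mod_cast (card_le_card (erase_subset _ _)).trans (card_range k).le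
      have h6 := mul_le_mul_of_nonneg_right h5 (Nat.cast_nonneg (α := ℝ) #(B i))
      have h7 := mul_le_mul_of_nonneg_right h3 (show (0 : ℝ) ≤ 2 * k by positivity)
      linarith
    have h3 : (#(((range k).erase i).biUnion fun j => bad i j) : ℝ) * 2 ≤ #(B i) := by
      refine le_of_mul_le_mul_left ?_ hk
      linarith
    have h4 : #(((range k).erase i).biUnion fun j => bad i j) * 2 ≤ #(B i) := by exact_mod_cast h3
    have h5 := (card_le_card h1).trans (card_union_le _ _)
    omega
  refine ⟨fun i => {x ∈ B i | ∀ j < k, i ≠ j →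
    (#{y ∈ B j | ¬ T.Fwd i j x y} : ℝ) ≤ μ / 2 * #(B j)},
    fun i hi => ⟨filter_subset _ _, hB' i hi⟩, fun i hi j hj hij x hx => ?_⟩
  have h1 := (mem_filter.1 hx).2 j hj hij
  -- Halving `B j` at most doubles the proportion μ/2.
  have h2 : (#(B j) : ℝ) ≤ 2 * #{x ∈ B j | ∀ i < k, j ≠ i →
      (#{y ∈ B i | ¬ T.Fwd j i x y} : ℝ) ≤ μ / 2 * #(B i)} := by exact_mod_cast hB' j hj
  refine (Nat.cast_le.2 (card_le_card (filter_subset_filter _ (filter_subset _ _)))).trans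
    (h1.trans ?_)
  have := mul_le_mul_of_nonneg_left h2 (show (0 : ℝ) ≤ μ / 2 by positivity)
  linarith

end Blocks

end Tournament

namespace Tournament

open Finset
open scoped Classical

/-! ### Critical sets -/

section Critical

variable {V : Type*} {T : Tournament V} {X : Finset V} {ε : ℝ}

/-- A minimal set without a transitive subset of size at least its cardinality to the `ε`. -/
structure Critical (T : Tournament V) (ε : ℝ) (X : Finset V) : Prop where
  card_lt : ∀ S ⊆ X, T.TransitiveOn S → (#S : ℝ) < (#X : ℝ) ^ ε
  exists_of_ssubset : ∀ Y ⊂ X, ∃ S ⊆ Y, T.TransitiveOn S ∧ (#Y : ℝ) ^ ε ≤ #S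

theorem Critical.pos (hX : T.Critical ε X) : 0 < (#X : ℝ) ^ ε := by
  simpa using hX.card_lt ∅ (empty_subset _) ⟨fun _ => 0, by simp⟩

/-- Passing to a subset of proportion c costs only the factor c ^ ε, which is close to 1 when ε is
small. -/
theorem Critical.exists_transitiveOn (hX : T.Critical ε X) (hε : 0 < ε) {c : ℝ} (hc : 0 < c)
    (hcε : 199 / 200 ≤ c ^ ε) {Y : Finset V} (hY : Y ⊂ X) (hYc : c * #X ≤ #Y) :
    ∃ S ⊆ Y, T.TransitiveOn S ∧ 199 / 200 * (#X : ℝ) ^ ε ≤ #S := by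
  obtain ⟨S, hS, hST, hSc⟩ := hX.exists_of_ssubset Y hY
  refine ⟨S, hS, hST, le_trans ?_ hSc⟩
  calc 199 / 200 * (#X : ℝ) ^ ε ≤ c ^ ε * (#X : ℝ) ^ ε :=
        mul_le_mul_of_nonneg_right hcε hX.pos.le
    _ = (c * #X) ^ ε := (Real.mul_rpow hc.le (Nat.cast_nonneg _)).symm
    _ ≤ (#Y : ℝ) ^ ε := Real.rpow_le_rpow (by positivity) hYc hε.le

/-- In a critical set, a large subset is never complete to or from a large transitive subset. -/
theorem Critical.not_complete (hX : T.Critical ε X) (hε : 0 < ε) {c : ℝ} (hc : 0 < c)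
    (hcε : 199 / 200 ≤ c ^ ε) {Y S : Finset V} (hY : Y ⊆ X) (hYc : c * #X ≤ #Y) (hS : S ⊆ X)
    (hST : T.TransitiveOn S) (hSc : (#X : ℝ) ^ ε / 160 ≤ #S) :
    ¬ (∀ y ∈ Y, ∀ s ∈ S, T.Adj y s) ∧ ¬ (∀ y ∈ Y, ∀ s ∈ S, T.Adj s y) := by
  have hpos := hX.pos
  have hSne : S.Nonempty := by
    have : (0 : ℝ) < #S := by linarith
    exact card_pos.1 (by exact_mod_cast this)
  -- A transitive union would have at least (199/200 + 1/160) |X|^ε > |X|^ε vertices.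
  have key : Disjoint Y S → ∃ S' ⊆ Y, T.TransitiveOn S' ∧ ¬ T.TransitiveOn (S' ∪ S) := by
    intro hd
    obtain ⟨s, hs⟩ := hSne
    have hYX : Y ⊂ X :=
      Finset.ssubset_iff_subset_ne.2 ⟨hY, fun h => disjoint_left.1 hd (h ▸ hS hs) hs⟩
    obtain ⟨S', hS', hST', hSc'⟩ := hX.exists_transitiveOn hε hc hcε hYX hYc
    refine ⟨S', hS', hST', fun h => ?_⟩
    have h1 := hX.card_lt _ (union_subset (hS'.trans hY) hS) h
    rw [card_union_of_disjoint (hd.mono_left hS'), Nat.cast_add] at h1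
    linarith
  constructor
  · intro h
    obtain ⟨S', hS', hST', hn⟩ :=
      key (disjoint_iff_ne.2 fun y hy s hs => T.ne_of_adj (h y hy s hs))
    exact hn (hST'.union hST fun y hy s hs => h y (hS' hy) s hs)
  · intro h
    obtain ⟨S', hS', hST', hn⟩ :=
      key (disjoint_iff_ne.2 fun y hy s hs => (T.ne_of_adj (h y hy s hs)).symm)
    rw [union_comm] at hn
    exact hn (hST.union hST' fun s hs y hy => h y (hS' hy) s hs)

/-- A critical set with seven large blocks contains a layered family. -/
theorem Critical.exists_layered (hX : T.Critical ε X) (hε : 0 < ε) {κ : ℝ} (hκ : 0 < κ)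
    (hκε : 199 / 200 ≤ (κ / 32) ^ ε) (hlarge : 100 ≤ (#X : ℝ) ^ ε) (L : ℕ → Finset V)
    (hL : ∀ i < 7, L i ⊆ X ∧ κ * #X ≤ #(L i))
    (hLL : ∀ i j, i < j → j < 7 → T.IsSparsePair (1 / 40000) (L i) (L j)) :
    ∃ B, T.Layered B := by
  have hXpos : (0 : ℝ) < #X := by
    rcases (Nat.cast_nonneg (α := ℝ) #X).eq_or_lt' with h | h
    · rw [h, Real.zero_rpow hε.ne'] at hlarge
      norm_num at hlarge
    · exact h
  -- 4 · 7 / 40000 ≤ 1/1200, and the second smoothing below uses 4 · 15 / 1200 = 1/20. Each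
  -- smoothing halves the sets and `cross` takes an eighth, whence κ/32, and |X|^ε / 160 starting
  -- from |X|^ε / 10.
  obtain ⟨M, hM, hMM⟩ := T.exists_smooth_blocks (k := 7) (c := 1 / 40000) (μ := 1 / 1200)
    (by norm_num) (by norm_num) L hLL
  have hMX : ∀ i < 7, M i ⊆ X := fun i hi => (hM i hi).1.trans (hL i hi).1
  have hMc : ∀ i < 7, κ / 2 * #X ≤ #(M i) := fun i hi => by
    have h1 : (#(L i) : ℝ) ≤ 2 * #(M i) := by exact_mod_cast (hM i hi).2
    linarith [(hL i hi).2]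
  have hMd : ∀ i j, i < j → j < 7 → Disjoint (M i) (M j) := fun i j hij hj =>
    (hLL i j hij hj).1.mono (hM i (by omega)).1 (hM j hj).1
  have hMne : ∀ i < 7, (M i).Nonempty := fun i hi => by
    have : (0 : ℝ) < #(M i) := lt_of_lt_of_le (by positivity) (hMc i hi)
    exact card_pos.1 (by exact_mod_cast this)
  have hM2 : M 2 ⊂ X := by
    obtain ⟨x, hx⟩ := hMne 0 (by norm_num)
    refine Finset.ssubset_iff_subset_ne.2 ⟨hMX 2 (by norm_num), fun h => ?_⟩
    exact disjoint_left.1 (hMd 0 2 (by norm_num) (by norm_num)) hx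
      (h ▸ hMX 0 (by norm_num) hx)
  obtain ⟨F, hF, hFT, hFc⟩ := hX.exists_transitiveOn hε (by positivity) hκε hM2
    (le_trans (mul_le_mul_of_nonneg_right (by linarith) hXpos.le) (hMc 2 (by norm_num)))
  obtain ⟨C, hC, hCC⟩ := hFT.exists_parts 9 (m := #F / 9) (Nat.mul_div_le _ _)
  have hCF : ∀ i < 9, C i ⊆ M 2 := fun i hi => (hC i hi).1.trans hF
  -- Rounding down loses less than 1, which `hlarge` absorbs in the gap between 199/1800 and 1/10.
  have hm : (#X : ℝ) ^ ε / 10 ≤ (#F / 9 : ℕ) := by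
    have h1 : #F < 9 * (#F / 9 + 1) := Nat.lt_mul_div_succ _ (by norm_num)
    have h2 : (#F : ℝ) < 9 * ((#F / 9 : ℕ) + 1) := by exact_mod_cast h1
    linarith
  have hleft : ∀ p q, p < q → q < 7 → ∀ A ⊆ M p, T.IsSparsePair (1 / 1200) A (M q) := by
    refine fun p q hpq hq A hA => ⟨(hMd p q hpq hq).mono_left hA, ?_⟩
    rw [backCount, Nat.cast_sum]
    refine (sum_le_card_nsmul A _ (1 / 1200 * #(M q) : ℝ) fun x hx => ?_).trans
      (le_of_eq (by rw [nsmul_eq_mul]; ring))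
    refine le_trans (Nat.cast_le.2 (card_le_card fun y hy => ?_))
      (hMM p (by omega) q hq hpq.ne x (hA hx))
    rw [mem_filter] at hy
    rw [mem_filter, T.fwd_of_lt hpq]
    exact ⟨hy.1, T.not_adj_of_adj hy.2⟩
  have hright : ∀ p q, p < q → q < 7 → ∀ A ⊆ M q, T.IsSparsePair (1 / 1200) (M p) A := by
    refine fun p q hpq hq A hA => ⟨(hMd p q hpq hq).mono_right hA, ?_⟩
    rw [backCount_eq, Nat.cast_sum]
    refine (sum_le_card_nsmul A _ (1 / 1200 * #(M p) : ℝ) fun x hx => ?_).trans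
      (le_of_eq (by rw [nsmul_eq_mul]; ring))
    refine le_trans (Nat.cast_le.2 (card_le_card fun y hy => ?_))
      (hMM q hq p (by omega) hpq.ne' x (hA hx))
    rw [mem_filter] at hy
    rw [mem_filter, T.fwd_of_gt hpq]
    exact ⟨hy.1, T.not_adj_of_adj hy.2⟩
  -- The nine parts of the transitive set replace block 2: layers 0, 1 and 11, …, 14 are the other
  -- six blocks.
  let D : ℕ → Finset V := fun i => if i < 2 then M i else if i < 11 then C (i - 2) else M (i - 8)
  have hDlo : ∀ i, i < 2 → D i = M i := fun i hi => if_pos hi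
  have hDmid : ∀ i, 2 ≤ i → i < 11 → D i = C (i - 2) := fun i h2 hi => 
    (if_neg (by omega)).trans (if_pos hi)
  have hDhi : ∀ i, 11 ≤ i → D i = M (i - 8) := fun i hi => 
    (if_neg (by omega)).trans (if_neg (by omega))
  have hDD : ∀ i j, i < j → j < 15 → T.IsSparsePair (1 / 1200) (D i) (D j) := by
    intro i j hij hj
    rcases lt_or_ge i 2 with hi | hi
    · rw [hDlo i hi]
      rcases lt_or_ge j 2 with hj2 | hj2
      · rw [hDlo j hj2]
        exact hleft i j hij (by omega) _ (Subset.refl _)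
      rcases lt_or_ge j 11 with hj11 | hj11
      · rw [hDmid j hj2 hj11]
        exact hright i 2 hi (by norm_num) _ (hCF _ (by omega))
      · rw [hDhi j hj11]
        exact hleft i (j - 8) (by omega) (by omega) _ (Subset.refl _)
    rcases lt_or_ge i 11 with hi11 | hi11
    · rw [hDmid i hi hi11]
      rcases lt_or_ge j 11 with hj11 | hj11
      · rw [hDmid j (by omega) hj11]
        have hcc := hCC (i - 2) (j - 2) (by omega) (by omega)
        refine ⟨disjoint_iff_ne.2 fun x hx y hy => T.ne_of_adj (hcc x hx y hy), ?_⟩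
        have h0 : T.backCount (C (i - 2)) (C (j - 2)) = 0 :=
          sum_eq_zero fun x hx => card_eq_zero.2 (filter_eq_empty_iff.2 fun y hy =>
            T.not_adj_of_adj (hcc x hx y hy))
        rw [h0, Nat.cast_zero]
        positivity
      · rw [hDhi j hj11]
        exact hleft 2 (j - 8) (by omega) (by omega) _ (hCF _ (by omega))
    · rw [hDhi i hi11, hDhi j (by omega)]
      exact hleft (i - 8) (j - 8) (by omega) (by omega) _ (Subset.refl _)
  obtain ⟨B, hB, hBB⟩ := T.exists_smooth_blocks (k := 15) (c := 1 / 1200) (μ := 1 / 20)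
    (by norm_num) (by norm_num) D hDD
  have hne : ∀ i < 15, ∀ j < 15, i ≠ j → ∀ x ∈ B i, ∀ y ∈ B j, x ≠ y := by
    intro i hi j hj hij x hx y hy
    rcases lt_or_gt_of_ne hij with h | h
    · exact disjoint_iff_ne.1 (hDD i j h hj).1 x ((hB i hi).1 hx) y ((hB j hj).1 hy)
    · exact (disjoint_iff_ne.1 (hDD j i h hi).1 y ((hB j hj).1 hy) x ((hB i hi).1 hx)).symm
  have hBmid : ∀ i, 2 ≤ i → i ≤ 10 → B i ⊆ F ∧ (#X : ℝ) ^ ε / 20 ≤ #(B i) := by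
    intro i h2 h10
    obtain ⟨h1, h3⟩ := hB i (by omega)
    rw [hDmid i h2 (by omega)] at h1 h3
    rw [(hC (i - 2) (by omega)).2] at h3
    have h4 : ((#F / 9 : ℕ) : ℝ) ≤ 2 * #(B i) := by exact_mod_cast h3
    exact ⟨h1.trans (hC (i - 2) (by omega)).1, by linarith⟩
  have hBlin : ∀ i < 15, ¬ (2 ≤ i ∧ i ≤ 10) → B i ⊆ X ∧ κ / 4 * #X ≤ #(B i) := by
    intro i hi hi'
    obtain ⟨p, hp, hDp⟩ : ∃ p < 7, D i = M p := by
      rcases lt_or_ge i 2 with h | h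
      · exact ⟨i, by omega, hDlo i h⟩
      · exact ⟨i - 8, by omega, hDhi i (by omega)⟩
    obtain ⟨h1, h3⟩ := hB i hi
    rw [hDp] at h1 h3
    have h4 : (#(M p) : ℝ) ≤ 2 * #(B i) := by exact_mod_cast h3
    exact ⟨h1.trans (hMX p hp), by linarith [hMc p hp]⟩
  have hcross : ∀ i < 15, ∀ j < 15, i ≠ j → ¬ (2 ≤ i ∧ i ≤ 10) →
      ∀ Y ⊆ B i, ∀ Z ⊆ B j, #(B i) ≤ 8 * #Y → #(B j) ≤ 8 * #Z →
        ∃ y ∈ Y, ∃ z ∈ Z, ¬ T.Fwd i j y z := by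
    intro i hi j hj hij hi' Y hY Z hZ hYc hZc
    obtain ⟨hiX, hic⟩ := hBlin i hi hi'
    have hYc' : (#(B i) : ℝ) ≤ 8 * #Y := by exact_mod_cast hYc
    have hZc' : (#(B j) : ℝ) ≤ 8 * #Z := by exact_mod_cast hZc
    have hYX : κ / 32 * #X ≤ #Y := by linarith
    have hYne : Y.Nonempty := by
      have : (0 : ℝ) < #Y := lt_of_lt_of_le (by positivity) hYX
      exact card_pos.1 (by exact_mod_cast this)
    -- In a middle layer `Z` is itself transitive; in a linear layer minimality supplies a
    -- transitive subset.
    obtain ⟨S, hSZ, hSX, hST, hSc⟩ : ∃ S ⊆ Z, S ⊆ X ∧ T.TransitiveOn S ∧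
        (#X : ℝ) ^ ε / 160 ≤ #S := by
      by_cases hj' : 2 ≤ j ∧ j ≤ 10
      · obtain ⟨h1, h2⟩ := hBmid j hj'.1 hj'.2
        exact ⟨Z, Subset.refl _, (hZ.trans h1).trans (hF.trans hM2.1), hFT.subset (hZ.trans h1),
          by linarith⟩
      · obtain ⟨hjX, hjc⟩ := hBlin j hj hj'
        have hZX : Z ⊂ X := by
          obtain ⟨y, hy⟩ := hYne
          refine Finset.ssubset_iff_subset_ne.2 ⟨hZ.trans hjX, fun h => ?_⟩
          have hyZ : y ∈ Z := h ▸ hiX (hY hy)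
          exact hne i hi j hj hij y (hY hy) y (hZ hyZ) rfl
        obtain ⟨S, hS, hST, hSc⟩ := hX.exists_transitiveOn hε (by positivity) hκε hZX
          (by linarith)
        exact ⟨S, hS, hS.trans hZX.1, hST, by linarith⟩
    obtain ⟨h1, h2⟩ := hX.not_complete hε (by positivity) hκε (hY.trans hiX) hYX hSX hST hSc
    by_contra! hcon
    rcases lt_or_gt_of_ne hij with h | h
    · exact h1 fun y hy s hs => (T.fwd_of_lt h).1 (hcon y hy s (hSZ hs))
    · exact h2 fun y hy s hs => (T.fwd_of_gt h).1 (hcon y hy s (hSZ hs))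
  refine ⟨B, fun i hi => ?_, hne, fun i hi j hj hij x hx => ?_, ?_, ?_⟩
  · have : (0 : ℝ) < #(B i) := by
      by_cases h : 2 ≤ i ∧ i ≤ 10
      · linarith [(hBmid i h.1 h.2).2]
      · exact lt_of_lt_of_le (by positivity) (hBlin i hi h).2
    exact card_pos.1 (by exact_mod_cast this)
  · have h1 := hBB i hi j hj hij x hx
    have h2 : (20 * #{y ∈ B j | ¬ T.Fwd i j x y} : ℝ) ≤ #(B j) := by linarith
    exact_mod_cast h2
  · intro i j hi hij hj x hx y hy
    have hxC := (hB i (by omega)).1 hx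
    have hyC := (hB j (by omega)).1 hy
    rw [hDmid i hi (by omega)] at hxC
    rw [hDmid j (by omega) (by omega)] at hyC
    exact hCC (i - 2) (j - 2) (by omega) (by omega) x hxC y hyC
  · intro i hi j hj hij hn Y hY Z hZ hYc hZc
    by_cases hi' : 2 ≤ i ∧ i ≤ 10
    · obtain ⟨z, hz, y, hy, h⟩ :=
        hcross j hj i hi hij.symm (by tauto) Z hZ Y hY hZc hYc
      exact ⟨y, hy, z, hz, by rwa [T.fwd_comm hij]⟩
    · exact hcross i hi j hj hij hi' Y hY Z hZ hYc hZc

end Critical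

/-! ### The main result -/

/-- Both powers tend to 1 as ε tends to 0. -/
theorem exists_exponent (c K : ℝ) (hc : 0 < c) (hK : 0 < K) :
    ∃ ε : ℝ, 0 < ε ∧ 199 / 200 ≤ c ^ ε ∧ K ^ ε ≤ 2 := by
  have h1 : ∀ᶠ ε in nhds (0 : ℝ), 199 / 200 < c ^ ε :=
    (Real.continuous_const_rpow hc.ne').continuousAt.eventually
      (lt_mem_nhds (by norm_num [Real.rpow_zero]))
  have h2 : ∀ᶠ ε in nhds (0 : ℝ), K ^ ε < 2 :=
    (Real.continuous_const_rpow hK.ne').continuousAt.eventually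
      (gt_mem_nhds (by norm_num [Real.rpow_zero]))
  obtain ⟨ε, ⟨h1, h2⟩, hε⟩ :=
    (((h1.and h2).filter_mono nhdsWithin_le_nhds).and
      (self_mem_nhdsWithin (s := Set.Ioi (0 : ℝ)))).exists
  exact ⟨ε, hε, h1.le, h2.le⟩

/-- Two tournaments following a path pattern and a triangle pattern together satisfy the
Erdős–Hajnal conjecture. -/
theorem exists_transitive_of_patterns {τ τ' : Fin 7 → Fin 8} {H H' : Tournament (Fin 7)}
    (hH : IsPattern pathPairs τ H) (hτ : IsAdmissible τ) (hH' : IsPattern trianglePairs τ' H')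
    (hτ' : IsAdmissible τ') : ∃ ε : ℝ, 0 < ε ∧ ∀ (V : Type u) [Fintype V] (T : Tournament V),
      ¬ T.Contains H → ¬ T.Contains H' → ∃ X : Finset V,
        (T.induce (X : Set V)).IsTransitive ∧ (Fintype.card V : ℝ) ^ ε ≤ (#X : ℝ) := by
  obtain ⟨κ, hκ, N, hblocks⟩ := exists_blocks.{u} H (c := 1 / 40000) (by norm_num) 7
  obtain ⟨ε, hε, hκε, hKε⟩ := exists_exponent (κ / 32) (2 ^ 100 + N) (by positivity)
    (by positivity)
  refine ⟨ε, hε, fun V _ T hT hT' => ?_⟩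
  have main : ∀ X : Finset V, ∃ S ⊆ X, T.TransitiveOn S ∧ (#X : ℝ) ^ ε ≤ #S := by
    intro X
    induction X using Finset.strongInduction with
    | H X ih =>
      by_contra! hcon
      have hX : T.Critical ε X := ⟨hcon, ih⟩
      have hpow : ∀ k : ℕ, 2 ^ k ≤ #X → (k + 1 : ℝ) < (#X : ℝ) ^ ε := fun k hk => by
        obtain ⟨S, hS, hST, hSc⟩ := exists_transitiveOn_of_two_pow_le (T := T) k X hk
        have := hcon S hS hST
        rw [hSc] at this
        exact_mod_cast this
      have hX0 : #X ≠ 0 := fun h => by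
        have := hX.pos
        rw [h, Nat.cast_zero, Real.zero_rpow hε.ne'] at this
        exact lt_irrefl _ this
      have hX1 : #X ≠ 1 := fun h => by
        have := hpow 0 (by omega)
        rw [h] at this
        norm_num at this
      have hX2 := hpow 1 (by omega)
      -- Any two vertices form a transitive set, so |X|^ε > 2, whereas `hKε` gives |X|^ε ≤ 2 below
      -- this bound. Then 2 ^ 100 vertices contain 101 forming a transitive set, so |X|^ε > 101.
      have hbig : (2 ^ 100 + N : ℝ) ≤ #X := by
        by_contra! h
        have := Real.rpow_le_rpow (Nat.cast_nonneg _) h.le hε.le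
        push_cast at hX2
        linarith
      have hbig' : 2 ^ 100 + N ≤ #X := by exact_mod_cast hbig
      have hlarge := hpow 100 ((Nat.le_add_right _ N).trans hbig')
      obtain ⟨L, hL, hLL⟩ := hblocks T hT X ((Nat.le_add_left N _).trans hbig')
      obtain ⟨B, hB⟩ := hX.exists_layered hε hκ hκε (by push_cast at hlarge; linarith) L hL hLL
      rcases hB.contains_or_contains hH hτ hH' hτ' with h | h
      · exact hT h
      · exact hT' h
  obtain ⟨S, -, hST, hSc⟩ := main univ
  exact ⟨S, hST.isTransitive, by simpa using hSc⟩

end Tournament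

theorem mainTheorem12 :
    Tournament.SatisfyEHC.{u} ![Tournament.S6, Tournament.H14, Tournament.H22] ∧
    Tournament.SatisfyEHC.{u} ![Tournament.S11, Tournament.H42, Tournament.H49] ∧
    Tournament.SatisfyEHC.{u} ![Tournament.H24, Tournament.H28, Tournament.H36] ∧
    Tournament.SatisfyEHC.{u} ![Tournament.H5, Tournament.H19, Tournament.H33] := by
  open Tournament in
  refine ⟨?_, ?_, ?_, ?_⟩
  · obtain ⟨ε, hε, h⟩ := exists_transitive_of_patterns.{u} isPattern_H14 isAdmissible_H14
      isPattern_H22 isAdmissible_H22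
    exact ⟨ε, hε, fun V _ T hT => h V T (hT 1) (hT 2)⟩
  · obtain ⟨ε, hε, h⟩ := exists_transitive_of_patterns.{u} isPattern_H42 isAdmissible_H42
      isPattern_H49 isAdmissible_H49
    exact ⟨ε, hε, fun V _ T hT => h V T (hT 1) (hT 2)⟩
  · obtain ⟨ε, hε, h⟩ := exists_transitive_of_patterns.{u} isPattern_H36 isAdmissible_H36
      isPattern_H24 isAdmissible_H24
    exact ⟨ε, hε, fun V _ T hT => h V T (hT 2) (hT 0)⟩
  · obtain ⟨ε, hε, h⟩ := exists_transitive_of_patterns.{u} isPattern_H5 isAdmissible_H5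
      isPattern_H19 isAdmissible_H19
    exact ⟨ε, hε, fun V _ T hT => h V T (hT 0) (hT 1)⟩
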